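/- Let $\mathbb{F}_q$ be a finite field with $q$ elements, let $n\ge 1$, let $Q=\mathbb{F}_q[x_1,\dots,x_n]/(x_1^{q^2},\dots,x_n^{q^2})$, and let $G=GL_n(\mathbb{F}_q)$ act on $Q$ by invertible linear substitutions of the variables. Let $Q^G$ be the ring of invariants, graded by polynomial degree, and let $Hilb(Q^G,t)=\sum_{d\ge 0}\dim_{\mathbb{F}_q}(Q^G)_d\,t^d$. For $0\le k\le q$ put $$y_{n,k}=\sum_{\substack{i_1+\dots+i_n=(n-1)q+k\\ 0\le i_1,\dots,i_n\le q}}\ \prod_{j=1}^n x_j^{i_j(q-1)},\qquad z_n=\prod_{j=1}^n x_j^{q^2-1}.$$ (1) If $n\ge 2$, then $$Hilb(Q^G,t)=1+t^{(n-1)(q^2-q)}\left(1+t^{q-1}+t^{2(q-1)}+\dots+t^{q^2-q}\right)+t^{n(q^2-1)},$$ and the classes in $Q$ of the $q+3$ polynomials $1$, $y_{n,0},\dots,y_{n,q}$, $z_n$ form an $\mathbb{F}_q$-basis of $Q^G$. (2) If $n=1$, then $$Hilb(Q^G,t)=\frac{1-t^{q^2+q-2}}{1-t^{q-1}},$$ and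 the classes of the $q+2$ polynomials $y_{1,0}=1$, $y_{1,1},\dots,y_{1,q}$, $z_1$ form an $\mathbb{F}_q$-basis of $Q^G$. (3) Consequently, for every $n\ge 1$ the Lewis–Reiner–Stanton formula holds for $m=2$: $$Hilb(Q^G,t)=\sum_{k=0}^{\min(n,2)}t^{(n-k)(q^2-q^k)}\prod_{i=0}^{k-1}\frac{1-t^{q^2-q^i}}{1-t^{q^k-q^i}}.$$ -/

import Mathlib

namespace FrobInv

open MvPolynomial

section

variable {F : Type*} [Field F] {n : ℕ}

/-- The linear substitution `x_j ↦ ∑ i, g i j • x_i` on polynomials. -/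
noncomputable def linSubst (g : Matrix (Fin n) (Fin n) F) :
    MvPolynomial (Fin n) F →ₐ[F] MvPolynomial (Fin n) F :=
  aeval fun j => ∑ i, C (g i j) * X i

theorem linSubst_one : linSubst (1 : Matrix (Fin n) (Fin n) F) = AlgHom.id F _ := by
  ext j : 1
  simp [linSubst, Matrix.one_apply]

theorem linSubst_mul (g h : Matrix (Fin n) (Fin n) F) :
    linSubst (g * h) = (linSubst g).comp (linSubst h) := by
  ext j : 1
  simp only [linSubst, aeval_X, AlgHom.comp_apply, map_sum, map_mul, Matrix.mul_apply,
    ← algebraMap_eq, AlgHom.commutes, Finset.sum_mul, Finset.mul_sum]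
  rw [Finset.sum_comm]
  refine Finset.sum_congr rfl fun i _ => Finset.sum_congr rfl fun k _ => ?_
  ring

variable [Fintype F] (F n) (m : ℕ)

/-- The Frobenius power `(x_1^{q^m}, …, x_n^{q^m})`, where `q = |F|`. -/
noncomputable def frobIdeal : Ideal (MvPolynomial (Fin n) F) :=
  Ideal.span (Set.range fun i : Fin n => (X i : MvPolynomial (Fin n) F) ^ (Fintype.card F ^ m))

/-- The truncated polynomial ring `Q = F[x_1, …, x_n] / (x_1^{q^m}, …, x_n^{q^m})`. -/
abbrev Q : Type _ := MvPolynomial (Fin n) F ⧸ frobIdeal F n m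

variable {F n}

/-- Linear substitutions preserve the Frobenius power, so they act on the quotient. -/
theorem frobIdeal_le_comap (g : Matrix (Fin n) (Fin n) F) :
    frobIdeal F n m ≤ (frobIdeal F n m).comap (linSubst g) := by
  refine Ideal.span_le.2 ?_
  rintro _ ⟨j, rfl⟩
  obtain ⟨p, hp⟩ := CharP.exists F
  obtain ⟨k, hprime, hk⟩ := FiniteField.card F p
  have : Fact p.Prime := ⟨hprime⟩
  simp only [SetLike.mem_coe, Ideal.mem_comap, map_pow, linSubst, aeval_X]
  rw [hk, ← pow_mul, sum_pow_char_pow, ← Ideal.Quotient.eq_zero_iff_mem, map_sum]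
  refine Finset.sum_eq_zero fun i _ => Ideal.Quotient.eq_zero_iff_mem.2 ?_
  rw [mul_pow]
  refine Ideal.mul_mem_left _ _ (Ideal.subset_span ⟨i, ?_⟩)
  simp only [hk, ← pow_mul]

variable (F n)

/-- The action of `GL_n(F)` on `Q` by linear substitution of the variables. -/
noncomputable def action : GL (Fin n) F →* (Q F n m →ₐ[F] Q F n m) where
  toFun g := Ideal.quotientMapₐ (frobIdeal F n m) (linSubst (g : Matrix (Fin n) (Fin n) F))
    (frobIdeal_le_comap m _)
  map_one' := by
    refine Ideal.Quotient.algHom_ext _ (AlgHom.ext fun f => ?_)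
    simp [linSubst_one]
  map_mul' g h := by
    refine Ideal.Quotient.algHom_ext _ (AlgHom.ext fun f => ?_)
    simp [linSubst_mul]

/-- The invariant ring `Q^G` for `G = GL_n(F)`. -/
noncomputable def invariants : Subalgebra F (Q F n m) :=
  ⨅ g : GL (Fin n) F, AlgHom.equalizer (action F n m g) (AlgHom.id F (Q F n m))

theorem mem_invariants (f : Q F n m) :
    f ∈ invariants F n m ↔ ∀ g : GL (Fin n) F, action F n m g f = f := by
  simp [invariants, Algebra.mem_iInf]

/-- The degree `d` part of `Q`: the classes of homogeneous polynomials of degree `d`. -/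
noncomputable def degreePart (d : ℕ) : Submodule F (Q F n m) :=
  (homogeneousSubmodule (Fin n) F d).map (Ideal.Quotient.mkₐ F (frobIdeal F n m)).toLinearMap

/-- The Hilbert series `∑ d, dim (Q^G)_d t^d`. -/
noncomputable def hilbertSeries : PowerSeries ℚ :=
  PowerSeries.mk fun d =>
    (Module.finrank F ↥(Subalgebra.toSubmodule (invariants F n m) ⊓ degreePart F n m d) : ℚ)

/-- The `(q,t)`-binomial `∏_{i<k} (1 - t^{q^m - q^i}) / (1 - t^{q^k - q^i})`, as a power series;
for `2 ≤ q` all the denominators are units. -/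
noncomputable def qtBinom (q m k : ℕ) : PowerSeries ℚ :=
  ∏ i ∈ Finset.range k, ((1 - PowerSeries.X ^ (q ^ m - q ^ i)) *
    (1 - PowerSeries.X ^ (q ^ k - q ^ i))⁻¹)

/-- The series conjectured by Lewis, Reiner and Stanton to be the Hilbert series of `Q^G`. -/
noncomputable def lrsSeries (q n m : ℕ) : PowerSeries ℚ :=
  ∑ k ∈ Finset.range (min n m + 1),
    PowerSeries.X ^ ((n - k) * (q ^ m - q ^ k)) * qtBinom q m k

/-- The polynomial `y_{n,k}`: the sum of `∏ j, x_j^{i_j (q-1)}` over all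
`0 ≤ i_1, …, i_n ≤ q` with `i_1 + … + i_n = (n-1) q + k`. -/
noncomputable def yPoly (k : ℕ) : MvPolynomial (Fin n) F :=
  ∑ i : Fin n → Fin (Fintype.card F + 1) with
      ∑ j, (i j : ℕ) = (n - 1) * Fintype.card F + k,
    ∏ j, X j ^ ((i j : ℕ) * (Fintype.card F - 1))

/-- The polynomial `z_n = ∏ j, x_j^{q^2-1}`. -/
noncomputable def zPoly : MvPolynomial (Fin n) F :=
  ∏ j, X j ^ (Fintype.card F ^ 2 - 1)

end

end FrobInv

/-! A class in `Q` is determined by its coefficients on monomials whose exponents are all below `q ^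
2` (the box). Over a field, diagonal matrices and transvections generate `GL_n`, and conjugation by
the torus rescales transvections, so invariance splits into two conditions
(`mk_mem_invariants_iff`). The torus forces all box exponents to be multiples `i_j (q - 1)` with
`i_j ≤ q + 1`. The unit transvections `x_a ↦ x_a + x_b` remain.

Such a transvection fixes the degree in `x_a, x_b` jointly and the degree in every other variable.
On each such slice, written as a polynomial `g` in `X = x_a / x_b`, it acts by `X ↦ X + 1`.
Invariance in `Q` thus says that certain coefficients of `g(X + 1) - g(X)` vanish, namely those in
the box (`mk_linSubst_transvection_iff`).

For a pair with `s = i_a + i_b` this gives three relations. If `s ≤ 2q + 1`, neither entry is `q +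
1`. If `1 ≤ s < q`, the coefficient is zero. If `q ≤ s ≤ 2q`, the coefficient depends only on `s`
and on the other entries. Consequently one entry `q + 1` forces all of them to be `q + 1`, which is
`z_n`. Otherwise units can be moved between coordinates until all but one equal `q`, or until the
coefficient is seen to vanish; only the constant term escapes. Each coefficient therefore depends
only on the total degree, and the `y_{n,k}` span the rest (`IsReduced.coeff_eq_corner_or`,
`IsReduced.coeff_expo`).

Conversely the slices of `y_{n,k}` are truncated geometric sums, and multiplying by the
translation-invariant `X ^ q - X` shows that their differences have small degree
(`coeff_shiftDiff_geomPoly`). Coefficients at the corner exponents are dual to the generators, which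
yields the basis and the Hilbert series together. -/

namespace FrobInv

/-! ### Differences of one-variable polynomials over a finite field. -/

section Shift

open Polynomial

variable {F : Type*} [Field F]

/-- The difference operator `g(X) ↦ g(X + 1) - g(X)`. -/
noncomputable def shiftDiff : F[X] →ₗ[F] F[X] := taylor 1 - LinearMap.id

theorem shiftDiff_apply (g : F[X]) : shiftDiff g = taylor 1 g - g := rfl

/-- Translation preserves the degree and the leading coefficient, so the difference operator kills
the top term. -/
theorem coeff_shiftDiff_of_natDegree_le {g : F[X]} {u : ℕ} (h : g.natDegree ≤ u) :
    (shiftDiff g).coeff u = 0 := by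
  rw [shiftDiff_apply, coeff_sub]
  rcases h.eq_or_lt with rfl | h
  · rw [coeff_taylor_natDegree, leadingCoeff, sub_self]
  · rw [coeff_eq_zero_of_natDegree_lt h, coeff_eq_zero_of_natDegree_lt (by rwa [natDegree_taylor]),
      sub_self]

theorem shiftDiff_monomial (d : ℕ) (r : F) :
    shiftDiff (monomial d r) = C r * ((X + 1) ^ d - X ^ d) := by
  rw [shiftDiff_apply, taylor_monomial, ← C_mul_X_pow_eq_monomial, C_1, mul_sub]

theorem natDegree_X_add_one_pow_sub_X_pow_le (m : ℕ) :
    ((X + 1 : F[X]) ^ (m + 1) - X ^ (m + 1)).natDegree ≤ m := by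
  rw [natDegree_le_iff_coeff_eq_zero]
  intro u hu
  have := coeff_shiftDiff_of_natDegree_le (g := monomial (m + 1) (1 : F)) (u := u)
    ((natDegree_monomial_le _).trans hu)
  rwa [shiftDiff_monomial, C_1, one_mul] at this

/-- The term `c X ^ (d + 1)` contributes `(d + 1) c` in degree `d`, and lower terms contribute
nothing there. The application has `d + 1 = q ^ 2 - 1`, which is `-1` in `F`. -/
theorem coeff_eq_zero_of_natDegree_le_of_coeff_shiftDiff {g : F[X]} {d : ℕ}
    (hd : ((d + 1 : ℕ) : F) ≠ 0) (hg : g.natDegree ≤ d + 1)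
    (h : (shiftDiff g).coeff d = 0) : g.coeff (d + 1) = 0 := by
  have key : g = monomial (d + 1) (g.coeff (d + 1)) + (g - monomial (d + 1) (g.coeff (d + 1))) := by
    ring
  rw [key, map_add, coeff_add, coeff_shiftDiff_of_natDegree_le (g := g - _), add_zero,
    shiftDiff_monomial, coeff_C_mul, coeff_sub, coeff_X_add_one_pow, coeff_X_pow,
    if_neg (by omega), sub_zero, mul_eq_zero] at h
  · refine h.resolve_right ?_
    rwa [Nat.choose_succ_self_right]
  · rw [natDegree_le_iff_coeff_eq_zero]
    intro u hu
    rw [coeff_sub, coeff_monomial]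
    split_ifs with h1
    · rw [h1, sub_self]
    · rw [coeff_eq_zero_of_natDegree_lt (by omega), sub_zero]

variable [Fintype F]

local notation "q" => Fintype.card F

theorem add_pow_card {A : Type*} [CommRing A] [Algebra F A] (x y : A) :
    (x + y) ^ q = x ^ q + y ^ q := by
  have := map_add (FiniteField.frobeniusAlgHom F A) x y
  simpa only [FiniteField.coe_frobeniusAlgHom] using this

/-- A binomial coefficient computed from the base `q` digits of `i (q - 1)`. -/
theorem coeff_X_add_one_pow_mul_card_sub_one {i : ℕ} (h1 : 1 ≤ i) (hi : i ≤ q) :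
    ((X + 1 : F[X]) ^ (i * (q - 1))).coeff ((i - 1) * q) = 1 := by
  obtain ⟨j, rfl⟩ := Nat.exists_eq_add_of_le' h1
  obtain ⟨r, hr⟩ := Nat.exists_eq_add_of_le hi
  have e : (j + 1) * (q - 1) = q * j + r := by
    rw [hr, show j + 1 + r - 1 = j + r by omega]; ring
  have e' : (j + 1 - 1) * q = q * j := by rw [Nat.add_sub_cancel, mul_comm]
  -- By symmetry of binomials, degree `q * j` may be replaced by `r < q`. In `(X ^ q + 1) ^ j * (X +
  -- 1) ^ r` only the constant term of the first factor reaches degree `r`.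
  rw [e, e', coeff_X_add_one_pow, Nat.choose_symm_add, ← coeff_X_add_one_pow, pow_add, pow_mul,
    add_pow_card, one_pow]
  obtain ⟨w, hw⟩ := sub_dvd_pow_sub_pow ((X : F[X]) ^ q + 1) 1 j
  rw [one_pow, add_sub_cancel_right, sub_eq_iff_eq_add] at hw
  rw [hw, add_mul, one_mul, coeff_add, mul_assoc, coeff_X_pow_mul', if_neg (by omega), zero_add,
    coeff_X_add_one_pow, Nat.choose_self, Nat.cast_one]

/-- Compare leading terms: if the degree is `d (q - 1)` with `d ≥ 1`, the leading monomial
contributes its coefficient times 1 to the difference in degree `(d - 1) q`, while every other term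
has degree at most `(d - 1)(q - 1)` and contributes nothing there. -/
theorem coeff_eq_zero_of_coeff_shiftDiff {h : F[X]}
    (hsupp : ∀ u, h.coeff u ≠ 0 → ∃ i < q, u = i * (q - 1))
    (hD : ∀ i, 1 ≤ i → h.coeff (i * (q - 1)) ≠ 0 → (shiftDiff h).coeff ((i - 1) * q) = 0)
    {i : ℕ} (hi : 1 ≤ i) : h.coeff (i * (q - 1)) = 0 := by
  by_contra hne
  have hq : 1 < q := Fintype.one_lt_card
  have h0 : h ≠ 0 := by rintro rfl; simp at hne
  obtain ⟨d, hdq, hd⟩ := hsupp h.natDegree (leadingCoeff_ne_zero.2 h0)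
  have hid : i * (q - 1) ≤ d * (q - 1) := hd ▸ le_natDegree_of_ne_zero hne
  have hd1 : 1 ≤ d := hi.trans (Nat.le_of_mul_le_mul_right hid (by omega))
  have hlc : h.coeff (d * (q - 1)) ≠ 0 := hd ▸ leadingCoeff_ne_zero.2 h0
  have hz := hD d hd1 hlc
  -- This inequality amounts to `d < q`. At `d = q` the two degrees agree and the subtracted `X ^ (d
  -- * (q - 1))` would cancel the contribution.
  have hlt : (d - 1) * q < d * (q - 1) := by
    obtain ⟨c, rfl⟩ := Nat.exists_eq_add_of_le' hd1
    obtain ⟨r, hr⟩ := Nat.exists_eq_add_of_lt hdq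
    rw [hr]
    simp only [Nat.add_sub_cancel]
    nlinarith
  rw [← h.eraseLead_add_monomial_natDegree_leadingCoeff, map_add, coeff_add,
    coeff_shiftDiff_of_natDegree_le, zero_add, shiftDiff_monomial, hd, coeff_C_mul, coeff_sub,
    coeff_X_add_one_pow_mul_card_sub_one hd1 hdq.le, coeff_X_pow, if_neg hlt.ne, sub_zero,
    mul_one] at hz
  · exact h0 (leadingCoeff_eq_zero.1 hz)
  · rw [natDegree_le_iff_coeff_eq_zero]
    intro u hu
    by_contra hu'
    have hne' : u ≠ h.natDegree := by
      rintro rfl; exact hu' eraseLead_coeff_natDegree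
    rw [eraseLead_coeff_of_ne _ hne'] at hu'
    obtain ⟨j, -, rfl⟩ := hsupp u hu'
    have hle := le_natDegree_of_ne_zero hu'
    rw [hd] at hle
    have hjd : j ≤ d := Nat.le_of_mul_le_mul_right hle (by omega)
    have : j ≠ d := by rintro rfl; exact hne' hd.symm
    have h2 : j * (q - 1) ≤ (d - 1) * q := Nat.mul_le_mul (by omega) (by omega)
    omega

/-- The one-variable shadow `∑_{k ≤ i ≤ q} X^{i (q - 1)}` of the invariants `y_{2, k}`. -/
noncomputable def geomPoly (F : Type*) [Field F] [Fintype F] (k : ℕ) : F[X] :=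
  ∑ i ∈ Finset.Ico k (Fintype.card F + 1), X ^ (i * (Fintype.card F - 1))

theorem coeff_geomPoly (k i : ℕ) :
    (geomPoly F k).coeff (i * (q - 1)) = if k ≤ i ∧ i ≤ q then 1 else 0 := by
  have hq : 1 < q := Fintype.one_lt_card
  rw [geomPoly, finsetSum_coeff]
  simp only [coeff_X_pow]
  have : ∀ j, (i * (q - 1) = j * (q - 1)) ↔ i = j := fun j =>
    ⟨fun h => Nat.eq_of_mul_eq_mul_right (by omega) h, fun h => by rw [h]⟩
  simp only [this, Finset.sum_ite_eq, Finset.mem_Ico, Nat.lt_succ_iff]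

theorem exists_of_coeff_geomPoly_ne_zero {k u : ℕ} (h : (geomPoly F k).coeff u ≠ 0) :
    ∃ i, k ≤ i ∧ i ≤ q ∧ u = i * (q - 1) := by
  rw [geomPoly, finsetSum_coeff] at h
  obtain ⟨i, hi, hne⟩ := Finset.exists_ne_zero_of_sum_ne_zero h
  rw [coeff_X_pow] at hne
  rw [Finset.mem_Ico] at hi
  exact ⟨i, hi.1, by omega, by_contra fun h => hne (if_neg h)⟩

/-- Multiplication by `X ^ q - X` telescopes the sum to `X ^ q ^ 2 - X ^ (k (q - 1) + 1)`. Since `X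
^ q - X` is invariant under `X ↦ X + 1` and `X ^ q ^ 2` only changes by 1, the product of `X ^ q -
X` with the difference has degree at most `k (q - 1)`; dividing lowers this by `q`. -/
theorem coeff_shiftDiff_geomPoly {k u : ℕ} (hk : k ≤ q) (hu : k * (q - 1) < u + q) :
    (shiftDiff (geomPoly F k)).coeff u = 0 := by
  have hq : 1 < q := Fintype.one_lt_card
  have hgeom : (X ^ q - X) * geomPoly F k = X ^ q ^ 2 - X ^ (k * (q - 1) + 1) := by
    have h := geom_sum_Ico_mul ((X : F[X]) ^ (q - 1)) (m := k) (n := q + 1) (by omega)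
    have hX : (X : F[X]) ^ q - X = X * (X ^ (q - 1) - 1) := by
      rw [mul_sub, mul_one, ← pow_succ', Nat.sub_add_cancel hq.le]
    simp only [← pow_mul, mul_comm (q - 1)] at h
    rw [hX, mul_assoc, mul_comm (_ - 1), geomPoly, h, mul_sub, ← pow_succ', ← pow_succ']
    congr 2
    obtain ⟨r, hr⟩ := Nat.exists_eq_add_of_le' hq.le
    rw [hr, Nat.add_sub_cancel]; ring
  have hT : taylor 1 (X ^ q - X : F[X]) = X ^ q - X := by
    rw [map_sub, taylor_X_pow, taylor_X, C_1, add_pow_card, one_pow, add_sub_add_right_eq_sub]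
  have hsq : (X + 1 : F[X]) ^ q ^ 2 = X ^ q ^ 2 + 1 := by
    rw [pow_two, pow_mul, add_pow_card, one_pow, add_pow_card, one_pow, pow_mul]
  have hD : (X ^ q - X) * shiftDiff (geomPoly F k) =
      1 - ((X + 1) ^ (k * (q - 1) + 1) - X ^ (k * (q - 1) + 1)) := by
    have := congrArg (taylor 1) hgeom
    rw [taylor_mul, hT, map_sub, taylor_X_pow, taylor_X_pow, C_1, hsq] at this
    rw [shiftDiff_apply, mul_sub, this, hgeom]
    ring
  by_contra hne
  have h0 : shiftDiff (geomPoly F k) ≠ 0 := by intro h; simp [h] at hne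
  have hdeg := FiniteField.X_pow_card_sub_X_natDegree_eq F hq
  have hn0 : (X ^ q - X : F[X]) ≠ 0 := FiniteField.X_pow_card_sub_X_ne_zero F hq
  have := congrArg natDegree hD
  rw [natDegree_mul hn0 h0, hdeg] at this
  have h2 : (1 - ((X + 1 : F[X]) ^ (k * (q - 1) + 1) - X ^ (k * (q - 1) + 1))).natDegree
      ≤ k * (q - 1) :=
    (natDegree_sub_le _ _).trans
      (max_le (by simp) (natDegree_X_add_one_pow_sub_X_pow_le _))
  have h3 := le_natDegree_of_ne_zero hne
  omega

end Shift

/-! ### Transvections as translations of `x_a / x_b`. -/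

section Dehomogenize

open MvPolynomial

variable {F : Type*} [Field F] {n : ℕ}

/-- The substitution `x_a ↦ X x_b`, which separates the degrees in `x_a` and `x_b`. -/
noncomputable def dehomog (a b : Fin n) :
    MvPolynomial (Fin n) F →ₐ[F] MvPolynomial (Fin n) (Polynomial F) :=
  aeval fun j => if j = a then C Polynomial.X * X b else X j

theorem linSubst_transvection_X {a b : Fin n} (c : F) (j : Fin n) :
    linSubst (Matrix.transvection b a c) (X j) = if j = a then X a + C c * X b else X j := by
  have h : ∀ i, C ((Matrix.transvection b a c) i j) * X i =
      (if i = j then X i else 0) + (if i = b then (if j = a then C c * X i else 0) else 0 :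
        MvPolynomial (Fin n) F) := by
    intro i
    rw [Matrix.transvection, Matrix.add_apply, Matrix.one_apply, Matrix.single_apply, C_add,
      add_mul]
    congr 1
    · split_ifs <;> simp
    · simp only [eq_comm (a := b), eq_comm (a := a)]
      by_cases h1 : i = b <;> by_cases h2 : j = a <;> simp [h1, h2]
  simp only [linSubst, aeval_X, h, Finset.sum_add_distrib, Finset.sum_ite_eq', Finset.mem_univ,
    if_true]
  split_ifs with h2
  · rw [h2]
  · rw [add_zero]

/-- Under `x_a ↦ X x_b`, the image `x_a + x_b` of `x_a` becomes `(X + 1) x_b`. -/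
theorem dehomog_linSubst_transvection {a b : Fin n} (hab : a ≠ b) (P : MvPolynomial (Fin n) F) :
    dehomog a b (linSubst (Matrix.transvection b a 1) P) =
      MvPolynomial.map (Polynomial.taylorAlgHom (1 : F)).toRingHom (dehomog a b P) := by
  have : (dehomog a b).comp (linSubst (Matrix.transvection b a (1 : F))) =
      (MvPolynomial.mapAlgHom (Polynomial.taylorAlgHom (1 : F))).comp (dehomog a b) := by
    ext1 j
    rw [AlgHom.comp_apply, AlgHom.comp_apply, linSubst_transvection_X]
    by_cases hj : j = a
    · subst hj
      simp [dehomog, hab.symm, add_mul]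
    · simp [dehomog, hj]
  exact DFunLike.congr_fun this P

theorem dehomog_monomial (a b : Fin n) (m : Fin n →₀ ℕ) (r : F) :
    dehomog a b (monomial m r) =
      monomial (m.erase a + Finsupp.single b (m a)) (Polynomial.monomial (m a) r) := by
  have h : monomial m r = C r * (monomial (m.erase a) 1 * X a ^ (m a)) := by
    rw [X_pow_eq_monomial, monomial_mul, C_mul_monomial, mul_one, mul_one, Finsupp.erase_add_single]
  have h2 : dehomog a b (monomial (m.erase a) (1 : F)) = monomial (m.erase a) 1 := by
    rw [dehomog, aeval_monomial, map_one, one_mul, monomial_eq, C_1, one_mul]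
    refine Finsupp.prod_congr fun j hj => ?_
    rw [Finsupp.support_erase, Finset.mem_erase] at hj
    rw [if_neg hj.1]
  rw [h, map_mul, map_mul, h2, ← algebraMap_eq, AlgHom.commutes, map_pow,
    show dehomog a b (X a : MvPolynomial (Fin n) F) = C Polynomial.X * X b by simp [dehomog],
    mul_pow, X_pow_eq_monomial, ← C_pow, C_mul_monomial, monomial_mul,
    IsScalarTower.algebraMap_apply F (Polynomial F), algebraMap_eq, C_mul_monomial, mul_one,
    one_mul, Polynomial.algebraMap_eq, Polynomial.C_mul_X_pow_eq_monomial]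

/-- The part of `P` of degree `N` in `x_a, x_b` and of multidegree `d` in the other variables,
as a polynomial in `x_a / x_b`. -/
noncomputable def slice (a b : Fin n) (d : Fin n →₀ ℕ) (N : ℕ) (P : MvPolynomial (Fin n) F) :
    Polynomial F :=
  coeff (d + Finsupp.single b N) (dehomog a b P)

theorem slice_linSubst_transvection {a b : Fin n} (hab : a ≠ b) (d : Fin n →₀ ℕ) (N : ℕ)
    (P : MvPolynomial (Fin n) F) :
    slice a b d N (linSubst (Matrix.transvection b a 1) P) =
      Polynomial.taylor 1 (slice a b d N P) := by
  rw [slice, dehomog_linSubst_transvection hab, coeff_map]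
  rfl

theorem coeff_slice_of_lt {a b : Fin n} (P : MvPolynomial (Fin n) F)
    {d : Fin n →₀ ℕ} (hb : d b = 0) {N u : ℕ} (hu : N < u) :
    (slice a b d N P).coeff u = 0 := by
  rw [slice]
  induction P using MvPolynomial.induction_on' with
  | add p r hp hr => simp only [map_add, coeff_add, Polynomial.coeff_add, hp, hr, add_zero]
  | monomial m r =>
    rw [dehomog_monomial, coeff_monomial]
    split_ifs with h1
    · have := DFunLike.congr_fun h1 b
      simp only [Finsupp.add_apply, Finsupp.single_eq_same, hb] at this
      rw [Polynomial.coeff_monomial, if_neg (by omega)]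
    · rfl

theorem coeff_slice_add {a b : Fin n} (hab : a ≠ b) (P : MvPolynomial (Fin n) F)
    {d : Fin n →₀ ℕ} (ha : d a = 0) (hb : d b = 0) (u v : ℕ) :
    (slice a b d (u + v) P).coeff u =
      coeff (d + Finsupp.single a u + Finsupp.single b v) P := by
  rw [slice]
  induction P using MvPolynomial.induction_on' with
  | add p r hp hr => simp only [map_add, coeff_add, Polynomial.coeff_add, hp, hr]
  | monomial m r =>
    have key : (m.erase a + Finsupp.single b (m a) = d + Finsupp.single b (u + v) ∧ m a = u) ↔
        m = d + Finsupp.single a u + Finsupp.single b v := by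
      simp only [Finsupp.ext_iff, Finsupp.add_apply]
      constructor
      · rintro ⟨h, hu⟩ j
        have := h j
        by_cases hja : j = a
        · subst hja; simp [ha, hu, hab]
        · by_cases hjb : j = b
          · subst hjb
            simp only [Finsupp.erase_ne hja, Finsupp.single_eq_same, hb, hu] at this
            simp only [hb, Finsupp.single_eq_same, Finsupp.single_eq_of_ne hja]
            omega
          · simpa [hja, hjb] using this
      · intro h
        have hu : m a = u := by simp [h a, ha, hab]
        refine ⟨fun j => ?_, hu⟩
        have := h j
        by_cases hja : j = a
        · subst hja; simp [ha, hab]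
        · by_cases hjb : j = b
          · subst hjb
            simp only [hb, Finsupp.single_eq_same, Finsupp.single_eq_of_ne hja] at this
            simp only [Finsupp.erase_ne hja, Finsupp.single_eq_same, hb, hu]
            omega
          · simpa [hja, hjb] using this
    rw [dehomog_monomial, coeff_monomial, coeff_monomial, ← if_congr key rfl rfl, ite_and]
    by_cases h1 : m.erase a + Finsupp.single b (m a) = d + Finsupp.single b (u + v)
    · rw [if_pos h1, if_pos h1, Polynomial.coeff_monomial]
    · rw [if_neg h1, if_neg h1, Polynomial.coeff_zero]

end Dehomogenize

/-! ### Invariance in terms of coefficients in the box. -/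

section Criterion

open MvPolynomial

variable {F : Type*} [Field F] {n : ℕ}

theorem coeff_linSubst_diagonal (D : Fin n → F) (P : MvPolynomial (Fin n) F) (d : Fin n →₀ ℕ) :
    coeff d (linSubst (Matrix.diagonal D) P) = (∏ j, D j ^ d j) * coeff d P := by
  have hX : ∀ j, linSubst (Matrix.diagonal D) (X j) = C (D j) * X j := by
    intro j
    rw [linSubst, aeval_X, Finset.sum_eq_single j]
    · rw [Matrix.diagonal_apply_eq]
    · intro i _ hij
      rw [Matrix.diagonal_apply_ne _ hij, C_0, zero_mul]
    · simp
  induction P using MvPolynomial.induction_on' with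
  | add p r hp hr => simp only [map_add, coeff_add, hp, hr, mul_add]
  | monomial m r =>
    have : linSubst (Matrix.diagonal D) (monomial m r) = C (∏ j, D j ^ m j) * monomial m r := by
      rw [monomial_eq, Finsupp.prod_fintype _ _ (fun _ => pow_zero _), map_mul, map_prod]
      simp only [map_pow, hX, mul_pow, Finset.prod_mul_distrib, map_prod]
      rw [← algebraMap_eq, AlgHom.commutes]
      ring
    rw [this, coeff_C_mul, coeff_monomial]
    split_ifs with h
    · rw [h]
    · rw [mul_zero, mul_zero]

/-- The torus conjugates all transvections with nonzero parameter in a fixed position into each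
other, so parameter 1 suffices. -/
theorem transvection_eq_diagonal_mul {a b : Fin n} (hab : a ≠ b) {c : F} (hc : c ≠ 0) :
    Matrix.transvection b a c = Matrix.diagonal (Function.update 1 b c) *
      (Matrix.transvection b a 1 * Matrix.diagonal (Function.update 1 b c⁻¹)) := by
  ext i j
  rw [Matrix.diagonal_mul, Matrix.mul_diagonal]
  simp only [Matrix.transvection, Matrix.add_apply, Matrix.one_apply, Matrix.single_apply,
    Function.update_apply, Pi.one_apply]
  by_cases hi : i = b <;> by_cases hj : j = b
  · subst hi; subst hj; simp [hc, hab]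
  · subst hi; simp [hj, Ne.symm hj]
  · subst hj; simp [hi, Ne.symm hi]
  · simp [hi, hj, Ne.symm hi]

variable [Fintype F]

local notation "q" => Fintype.card F

/-- The ideal is monomial, so membership can be checked on each monomial separately. -/
theorem mem_frobIdeal_iff {m : ℕ} (P : MvPolynomial (Fin n) F) :
    P ∈ frobIdeal F n m ↔ ∀ d : Fin n →₀ ℕ, (∀ j, d j < q ^ m) → coeff d P = 0 := by
  have : frobIdeal F n m = Ideal.span ((fun s => monomial s (1 : F)) ''
      Set.range fun i : Fin n => Finsupp.single i (q ^ m)) := by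
    rw [frobIdeal, ← Set.range_comp]
    simp only [Function.comp_def, X_pow_eq_monomial]
  rw [this, mem_ideal_span_monomial_image]
  simp only [Set.mem_range, exists_exists_eq_and, Finsupp.single_le_iff, mem_support_iff]
  refine forall_congr' fun d => ⟨fun h hd => ?_, fun h hd => ?_⟩
  · by_contra hne
    obtain ⟨j, hj⟩ := h hne
    exact (hd j).not_ge hj
  · by_contra! hne
    exact hd (h hne)

theorem mk_eq_mk_iff {m : ℕ} (P R : MvPolynomial (Fin n) F) :
    Ideal.Quotient.mk (frobIdeal F n m) P = Ideal.Quotient.mk (frobIdeal F n m) R ↔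
      ∀ d : Fin n →₀ ℕ, (∀ j, d j < q ^ m) → coeff d P = coeff d R := by
  rw [Ideal.Quotient.eq, mem_frobIdeal_iff]
  simp only [coeff_sub, sub_eq_zero]

theorem mk_linSubst_transvection_iff {m : ℕ} {a b : Fin n} (hab : a ≠ b)
    (P : MvPolynomial (Fin n) F) :
    Ideal.Quotient.mk (frobIdeal F n m) (linSubst (Matrix.transvection b a 1) P) =
        Ideal.Quotient.mk (frobIdeal F n m) P ↔
      ∀ d : Fin n →₀ ℕ, d a = 0 → d b = 0 → (∀ j, d j < q ^ m) → ∀ u < q ^ m, ∀ v < q ^ m,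
        (shiftDiff (slice a b d (u + v) P)).coeff u = 0 := by
  rw [mk_eq_mk_iff]
  have key : ∀ d : Fin n →₀ ℕ, d a = 0 → d b = 0 → ∀ u v,
      (shiftDiff (slice a b d (u + v) P)).coeff u =
        coeff (d + Finsupp.single a u + Finsupp.single b v)
          (linSubst (Matrix.transvection b a 1) P) -
        coeff (d + Finsupp.single a u + Finsupp.single b v) P := by
    intro d ha hb u v
    rw [shiftDiff_apply, Polynomial.coeff_sub, ← slice_linSubst_transvection hab,
      coeff_slice_add hab _ ha hb, coeff_slice_add hab _ ha hb]
  constructor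
  · intro h d ha hb hd u hu v hv
    rw [key d ha hb, sub_eq_zero]
    refine h _ fun j => ?_
    by_cases hja : j = a
    · subst hja; simpa [ha, hab] using hu
    · by_cases hjb : j = b
      · subst hjb; simpa [hb, hja] using hv
      · simpa [hja, hjb] using hd j
  · intro h d hd
    have hdec : (d.erase a).erase b + Finsupp.single a (d a) + Finsupp.single b (d b) = d := by
      have h1 := Finsupp.erase_add_single b (d.erase a)
      rw [Finsupp.erase_ne hab.symm] at h1
      rw [add_right_comm, h1, Finsupp.erase_add_single]
    have ha : ((d.erase a).erase b) a = 0 := by rw [Finsupp.erase_ne hab, Finsupp.erase_same]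
    have hb : ((d.erase a).erase b) b = 0 := Finsupp.erase_same
    have := h _ ha hb (fun j => lt_of_le_of_lt ?_ (hd j)) (d a) (hd a) (d b) (hd b)
    · rwa [key _ ha hb, hdec, sub_eq_zero] at this
    · rw [Finsupp.erase_apply, Finsupp.erase_apply]
      split_ifs <;> simp

theorem action_mk (m : ℕ) (g : GL (Fin n) F) (P : MvPolynomial (Fin n) F) :
    action F n m g (Ideal.Quotient.mk _ P) =
      Ideal.Quotient.mk _ (linSubst (g : Matrix (Fin n) (Fin n) F) P) := rfl

theorem mk_linSubst_congr {m : ℕ} (g : Matrix (Fin n) (Fin n) F) {P R : MvPolynomial (Fin n) F}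
    (h : Ideal.Quotient.mk (frobIdeal F n m) P = Ideal.Quotient.mk (frobIdeal F n m) R) :
    Ideal.Quotient.mk (frobIdeal F n m) (linSubst g P) =
      Ideal.Quotient.mk (frobIdeal F n m) (linSubst g R) := by
  rw [Ideal.Quotient.eq] at h ⊢
  rw [← map_sub]
  exact frobIdeal_le_comap m g h

theorem mk_linSubst_of_mem_invariants {m : ℕ} {P : MvPolynomial (Fin n) F}
    (h : Ideal.Quotient.mk _ P ∈ invariants F n m) {g : Matrix (Fin n) (Fin n) F}
    (hg : g.det ≠ 0) :
    Ideal.Quotient.mk (frobIdeal F n m) (linSubst g P) = Ideal.Quotient.mk _ P := by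
  have := (mem_invariants F n m _).1 h (Matrix.GeneralLinearGroup.mkOfDetNeZero g hg)
  rwa [action_mk] at this

/-- Invariance under `GL_n` is invariance under the torus and the unit transvections. -/
theorem mk_mem_invariants_iff {m : ℕ} (P : MvPolynomial (Fin n) F) :
    Ideal.Quotient.mk _ P ∈ invariants F n m ↔
      (∀ d : Fin n →₀ ℕ, (∀ j, d j < q ^ m) → coeff d P ≠ 0 → ∀ j, q - 1 ∣ d j) ∧
      ∀ a b : Fin n, a ≠ b →
        Ideal.Quotient.mk (frobIdeal F n m) (linSubst (Matrix.transvection b a 1) P) =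
          Ideal.Quotient.mk (frobIdeal F n m) P := by
  constructor
  · intro h
    refine ⟨fun d hd hne j => ?_, fun a b hab => ?_⟩
    · obtain ⟨u, hu⟩ := IsCyclic.exists_generator (α := Fˣ)
      have hdet : (Matrix.diagonal (Function.update (1 : Fin n → F) j (u : F))).det ≠ 0 := by
        rw [Matrix.det_diagonal, Finset.prod_update_of_mem (Finset.mem_univ j)]
        simp
      have := (mk_eq_mk_iff _ _).1 (mk_linSubst_of_mem_invariants h hdet) d hd
      rw [coeff_linSubst_diagonal, mul_eq_right₀ hne, Finset.prod_eq_single j] at this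
      · rw [Function.update_self] at this
        have h1 : u ^ d j = 1 := Units.ext (by simpa using this)
        rw [← Nat.card_eq_fintype_card, ← Nat.card_units,
          ← orderOf_eq_card_of_forall_mem_zpowers hu]
        exact orderOf_dvd_of_pow_eq_one h1
      · intro i _ hij
        rw [Function.update_of_ne hij, Pi.one_apply, one_pow]
      · simp
    · refine mk_linSubst_of_mem_invariants h ?_
      rw [Matrix.det_transvection_of_ne _ _ hab.symm]
      exact one_ne_zero
  · rintro ⟨hT, hU⟩
    rw [mem_invariants]
    intro g
    rw [action_mk]
    let S : Matrix (Fin n) (Fin n) F → Prop := fun M =>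
      Ideal.Quotient.mk (frobIdeal F n m) (linSubst M P) = Ideal.Quotient.mk _ P
    have hmul : ∀ A B, S A → S B → S (A * B) := by
      intro A B hA hB
      change Ideal.Quotient.mk _ _ = _
      rw [linSubst_mul, AlgHom.comp_apply, mk_linSubst_congr A hB]
      exact hA
    have hdiag : ∀ D : Fin n → F, (Matrix.diagonal D).det ≠ 0 → S (Matrix.diagonal D) := by
      intro D hD
      rw [Matrix.det_diagonal, Finset.prod_ne_zero_iff] at hD
      refine (mk_eq_mk_iff _ _).2 fun d hd => ?_
      rw [coeff_linSubst_diagonal]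
      by_cases hne : coeff d P = 0
      · rw [hne, mul_zero]
      · rw [Finset.prod_eq_one, one_mul]
        intro j _
        obtain ⟨r, hr⟩ := hT d hd hne j
        rw [hr, pow_mul, FiniteField.pow_card_sub_one_eq_one _ (hD j (Finset.mem_univ j)), one_pow]
    refine Matrix.diagonal_transvection_induction_of_det_ne_zero S _ g.det_ne_zero hdiag ?_
      fun A B _ _ => hmul A B
    rintro ⟨b, a, hba, c⟩
    rw [Matrix.TransvectionStruct.toMatrix_mk]
    by_cases hc : c = 0
    · rw [hc, Matrix.transvection_zero]
      change Ideal.Quotient.mk _ _ = _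
      rw [linSubst_one, AlgHom.id_apply]
    · have hdet : ∀ c : F, c ≠ 0 →
          (Matrix.diagonal (Function.update (1 : Fin n → F) b c)).det ≠ 0 := by
        intro c hc
        rw [Matrix.det_diagonal, Finset.prod_update_of_mem (Finset.mem_univ b)]
        simpa using hc
      rw [transvection_eq_diagonal_mul hba.symm hc]
      exact hmul _ _ (hdiag _ (hdet c hc))
        (hmul _ _ (hU a b hba.symm) (hdiag _ (hdet _ (inv_ne_zero hc))))

end Criterion

/-! ### The one-variable relations for a pair of exponents with sum `s`. -/

section PairSequences

open MvPolynomial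

variable {F : Type*} [Field F] [Fintype F]

local notation "q" => Fintype.card F

theorem mul_card_sub_one_lt_iff (F : Type*) [Field F] [Fintype F] (i : ℕ) :
    i * (Fintype.card F - 1) < Fintype.card F ^ 2 ↔ i ≤ Fintype.card F + 1 := by
  obtain ⟨r, hr⟩ := Nat.exists_eq_add_of_lt (Fintype.one_lt_card (α := F))
  rw [hr, show 1 + r + 1 - 1 = r + 1 by omega]
  constructor
  · intro h
    by_contra! h2
    have := Nat.mul_le_mul_right (r + 1) (Nat.succ_le_of_lt h2)
    nlinarith
  · intro h
    have := Nat.mul_le_mul_right (r + 1) h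
    nlinarith

theorem mul_card_sub_one_inj (F : Type*) [Field F] [Fintype F] {i j : ℕ} :
    i * (Fintype.card F - 1) = j * (Fintype.card F - 1) ↔ i = j := by
  have := Fintype.one_lt_card (α := F)
  exact ⟨fun h => Nat.eq_of_mul_eq_mul_right (by omega) h, fun h => by rw [h]⟩

theorem card_sq_sub_one (F : Type*) [Field F] [Fintype F] :
    (Fintype.card F + 1) * (Fintype.card F - 1) = Fintype.card F ^ 2 - 1 := by
  rw [← Nat.sq_sub_sq, one_pow]

/-- The relation at `u = q ^ 2 - 2` reads off minus the top coefficient. The bound on `s` is what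
keeps the complementary exponent below `q ^ 2`; for `s = 2q + 2` it would be exactly `q ^ 2`, which
leaves room for `z_n`. -/
theorem coeff_top_eq_zero_of_shiftDiff {g : Polynomial F} {s : ℕ} (hs : s ≤ 2 * q + 1)
    (hsupp : ∀ u, g.coeff u ≠ 0 → ∃ r ≤ s, u = r * (q - 1) ∧ r ≤ q + 1)
    (hD : ∀ u < q ^ 2, ∀ v < q ^ 2, u + v = s * (q - 1) → (shiftDiff g).coeff u = 0) :
    g.coeff ((q + 1) * (q - 1)) = 0 := by
  by_contra hne
  obtain ⟨r, hrs, hr, -⟩ := hsupp _ hne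
  rw [mul_card_sub_one_inj] at hr
  subst hr
  have hq : 1 < q := Fintype.one_lt_card
  have h4 : 4 ≤ q ^ 2 := by nlinarith
  refine hne ?_
  have e : (q + 1) * (q - 1) = q ^ 2 - 2 + 1 := by rw [card_sq_sub_one]; omega
  rw [e]
  refine coeff_eq_zero_of_natDegree_le_of_coeff_shiftDiff ?_ ?_ ?_
  · rw [show q ^ 2 - 2 + 1 = q ^ 2 - 1 by omega, Nat.cast_sub (by omega), Nat.cast_pow,
      FiniteField.cast_card_eq_zero]
    simp
  · rw [← e, Polynomial.natDegree_le_iff_coeff_eq_zero]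
    intro u hu
    by_contra hu'
    obtain ⟨r, -, rfl, hr⟩ := hsupp u hu'
    exact absurd (Nat.mul_le_mul_right (q - 1) hr) hu.not_ge
  · have h1 : (q + 1) * (q - 1) ≤ s * (q - 1) := Nat.mul_le_mul_right _ hrs
    have h2 : s * (q - 1) ≤ (2 * q + 1) * (q - 1) := Nat.mul_le_mul_right _ hs
    have h3 : (2 * q + 1) * (q - 1) + (q - 1) = 2 * ((q + 1) * (q - 1)) := by ring
    rw [card_sq_sub_one] at h1 h3
    exact hD (q ^ 2 - 2) (by omega) (s * (q - 1) - (q ^ 2 - 2)) (by omega) (by omega)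

/-- Here `s (q - 1) < q ^ 2`, so every relation of the slice lies in the box. The case `r = 0` is
excluded because differences do not see constants. -/
theorem coeff_eq_zero_of_lt_of_shiftDiff {g : Polynomial F} {s : ℕ} (hs : s < q)
    (hsupp : ∀ u, g.coeff u ≠ 0 → ∃ r ≤ s, u = r * (q - 1))
    (hD : ∀ u < q ^ 2, ∀ v < q ^ 2, u + v = s * (q - 1) → (shiftDiff g).coeff u = 0)
    {r : ℕ} (hr : 1 ≤ r) : g.coeff (r * (q - 1)) = 0 := by
  refine coeff_eq_zero_of_coeff_shiftDiff (fun u hu => ?_) (fun i hi hne => ?_) hr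
  · obtain ⟨r, hr, rfl⟩ := hsupp u hu
    exact ⟨r, by omega, rfl⟩
  · obtain ⟨j, hj, hij⟩ := hsupp _ hne
    rw [mul_card_sub_one_inj] at hij
    subst hij
    have h1 : (i - 1) * q ≤ s * (q - 1) := by
      obtain ⟨c, rfl⟩ := Nat.exists_eq_add_of_le' hi
      obtain ⟨t, ht⟩ := Nat.exists_eq_add_of_lt hs
      have := Nat.mul_le_mul_right (q - 1) hj
      rw [ht] at this ⊢
      simp only [Nat.add_sub_cancel] at this ⊢
      nlinarith
    have h2 := (mul_card_sub_one_lt_iff F s).2 (by omega)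
    exact hD _ (by omega) (s * (q - 1) - (i - 1) * q) (by omega) (by omega)

/-- With `s = q + k`, subtracting the multiple of `geomPoly F k` that matches the coefficient at `q
(q - 1)` leaves support in `k ≤ i < q`. There the leading-term argument applies: its relations lie
in the box because `k ≤ i`, and `geomPoly` satisfies them too. -/
theorem coeff_eq_of_le_of_shiftDiff {g : Polynomial F} {s : ℕ} (hs : q ≤ s) (hs2 : s ≤ 2 * q)
    (hsupp : ∀ u, g.coeff u ≠ 0 → ∃ r ≤ s, u = r * (q - 1) ∧ r ≤ q ∧ s ≤ r + q)
    (hD : ∀ u < q ^ 2, ∀ v < q ^ 2, u + v = s * (q - 1) → (shiftDiff g).coeff u = 0)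
    {r : ℕ} (hr : 1 ≤ r) (hrs : s ≤ r + q) (hrq : r ≤ q) :
    g.coeff (r * (q - 1)) = g.coeff (q * (q - 1)) := by
  obtain ⟨k, rfl⟩ := Nat.exists_eq_add_of_le hs
  have hq : 1 < q := Fintype.one_lt_card
  have hk : k ≤ q := by omega
  set c := g.coeff (q * (q - 1)) with hc
  have hcoeff : ∀ u, (g - c • geomPoly F k).coeff u = g.coeff u - c * (geomPoly F k).coeff u := by
    intro u; simp
  have hG : ∀ i, (g - c • geomPoly F k).coeff (i * (q - 1)) ≠ 0 → k ≤ i ∧ i < q := by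
    intro i hi
    rw [hcoeff, coeff_geomPoly] at hi
    by_contra! hcon
    apply hi
    by_cases hki : k ≤ i
    · rcases (hcon hki).eq_or_lt with h | h
      · rw [← h, if_pos ⟨hk, le_rfl⟩, ← hc, mul_one, sub_self]
      · rw [if_neg (by omega), mul_zero, sub_zero]
        by_contra hne
        obtain ⟨j, -, hj, hjq, -⟩ := hsupp _ hne
        rw [mul_card_sub_one_inj] at hj
        omega
    · rw [if_neg (by omega), mul_zero, sub_zero]
      by_contra hne
      obtain ⟨j, -, hj, -, hjk⟩ := hsupp _ hne
      rw [mul_card_sub_one_inj] at hj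
      omega
  have hzero : (g - c • geomPoly F k).coeff (r * (q - 1)) = 0 := by
    refine coeff_eq_zero_of_coeff_shiftDiff (fun u hu => ?_) (fun i hi hne => ?_) hr
    · have : ∃ i, u = i * (q - 1) := by
        by_cases h : g.coeff u = 0
        · rw [hcoeff, h, zero_sub, neg_ne_zero] at hu
          obtain ⟨i, -, -, hi⟩ := exists_of_coeff_geomPoly_ne_zero (right_ne_zero_of_mul hu)
          exact ⟨i, hi⟩
        · obtain ⟨i, -, hi, -⟩ := hsupp u h
          exact ⟨i, hi⟩
      obtain ⟨i, rfl⟩ := this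
      exact ⟨i, (hG i hu).2, rfl⟩
    · obtain ⟨hki, hiq⟩ := hG i hne
      obtain ⟨j, rfl⟩ := Nat.exists_eq_add_of_le' hi
      obtain ⟨t, ht⟩ := Nat.exists_eq_add_of_lt hiq
      have hle : j * q ≤ (q + k) * (q - 1) := by
        have : j * q ≤ q * (q - 1) := by
          rw [mul_comm]; exact Nat.mul_le_mul_left _ (by omega)
        exact this.trans (Nat.mul_le_mul_right _ (by omega))
      have hlt : (q + k) * (q - 1) < j * q + q ^ 2 := by
        have hk' := Nat.mul_le_mul_right (q - 1) hki
        rw [ht] at hk' ⊢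
        simp only [Nat.add_sub_cancel] at hk' ⊢
        nlinarith
      rw [map_sub, map_smul, Polynomial.coeff_sub, Polynomial.coeff_smul,
        coeff_shiftDiff_geomPoly hk, smul_zero, sub_zero, Nat.add_sub_cancel]
      · have hj2 : j * q < q ^ 2 := by
          rw [pow_two]; exact Nat.mul_lt_mul_of_pos_right (by omega) (by omega)
        exact hD _ hj2 ((q + k) * (q - 1) - j * q) (by omega) (by omega)
      · have hk' := Nat.mul_le_mul_right (q - 1) hki
        have : (j + 1) * (q - 1) < (j + 1) * q := Nat.mul_lt_mul_of_pos_left (by omega) (by omega)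
        rw [Nat.add_sub_cancel]
        linarith
  rw [hcoeff, coeff_geomPoly, if_pos ⟨by omega, hrq⟩, mul_one, sub_eq_zero] at hzero
  exact hzero

end PairSequences

/-! ### Relations between coefficients of a reduced invariant polynomial. -/

section PairRelations

open MvPolynomial

variable {F : Type*} [Fintype F] {n : ℕ}

local notation "q" => Fintype.card F

/-- The exponent vector `(q - 1) i`. -/
noncomputable def expo (F : Type*) [Fintype F] (i : Fin n → ℕ) : Fin n →₀ ℕ :=
  Finsupp.equivFunOnFinite.symm fun j => i j * (Fintype.card F - 1)

theorem expo_apply (i : Fin n → ℕ) (j : Fin n) : expo F i j = i j * (q - 1) := rfl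

theorem expo_zero : expo F (0 : Fin n → ℕ) = 0 := by
  ext j
  rw [expo_apply, Pi.zero_apply, zero_mul, Finsupp.zero_apply]

theorem degree_expo (i : Fin n → ℕ) : (expo F i).degree = (∑ j, i j) * (q - 1) := by
  rw [Finsupp.degree_eq_sum, Finset.sum_mul]
  rfl

/-- The vector `i` with its entries at `a` and `b` replaced. -/
def setPair (i : Fin n → ℕ) (a b : Fin n) (r t : ℕ) : Fin n → ℕ :=
  Function.update (Function.update i a r) b t

theorem setPair_left (i : Fin n → ℕ) {a b : Fin n} (hab : a ≠ b) (r t : ℕ) :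
    setPair i a b r t a = r := by
  rw [setPair, Function.update_of_ne hab, Function.update_self]

theorem setPair_right (i : Fin n → ℕ) (a b : Fin n) (r t : ℕ) :
    setPair i a b r t b = t := Function.update_self ..

theorem setPair_of_ne (i : Fin n → ℕ) {a b j : Fin n} (r t : ℕ) (ha : j ≠ a) (hb : j ≠ b) :
    setPair i a b r t j = i j := by
  rw [setPair, Function.update_of_ne hb, Function.update_of_ne ha]

theorem setPair_self (i : Fin n → ℕ) (a b : Fin n) : setPair i a b (i a) (i b) = i := by
  rw [setPair, Function.update_eq_self, Function.update_eq_self]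

theorem setPair_swap (i : Fin n → ℕ) {a b : Fin n} (hab : a ≠ b) (r t : ℕ) :
    setPair i a b r t = setPair i b a t r := Function.update_comm hab ..

theorem setPair_setPair (i : Fin n → ℕ) {a b : Fin n} (hab : a ≠ b) (r t r' t' : ℕ) :
    setPair (setPair i a b r t) a b r' t' = setPair i a b r' t' := by
  funext j
  by_cases ha : j = a
  · subst ha; rw [setPair_left _ hab, setPair_left _ hab]
  · by_cases hb : j = b
    · subst hb; rw [setPair_right, setPair_right]
    · simp only [setPair_of_ne _ _ _ ha hb]

theorem setPair_le {i : Fin n → ℕ} {a b : Fin n} (hab : a ≠ b) {r t M : ℕ} (hi : ∀ j, i j ≤ M)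
    (hr : r ≤ M) (ht : t ≤ M) (j : Fin n) : setPair i a b r t j ≤ M := by
  by_cases ha : j = a
  · subst ha; rwa [setPair_left _ hab]
  · by_cases hb : j = b
    · subst hb; rwa [setPair_right]
    · rw [setPair_of_ne _ _ _ ha hb]; exact hi j

theorem expo_setPair (i : Fin n → ℕ) {a b : Fin n} (hab : a ≠ b) (r t : ℕ) :
    expo F (setPair i a b 0 0) + Finsupp.single a (r * (q - 1)) +
      Finsupp.single b (t * (q - 1)) = expo F (setPair i a b r t) := by
  ext j
  simp only [Finsupp.add_apply, expo_apply]
  by_cases ha : j = a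
  · subst ha; simp [setPair_left _ hab, hab]
  · by_cases hb : j = b
    · subst hb; simp [setPair_right, ha]
    · simp [setPair_of_ne _ _ _ ha hb, ha, hb]

variable [Field F]

theorem expo_injective : Function.Injective (expo F : (Fin n → ℕ) → Fin n →₀ ℕ) := by
  intro i i' h
  funext j
  have := DFunLike.congr_fun h j
  rwa [expo_apply, expo_apply, mul_card_sub_one_inj] at this

/-- A polynomial representing a class of `Q` that is fixed by the unit transvections, all of whose
exponents are multiples of `q - 1` less than `q ^ 2`. -/
structure IsReduced (P : MvPolynomial (Fin n) F) : Prop where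
  supp : ∀ d, coeff d P ≠ 0 → ∃ i, (∀ j, i j ≤ q + 1) ∧ d = expo F i
  inv : ∀ a b : Fin n, a ≠ b →
    Ideal.Quotient.mk (frobIdeal F n 2) (linSubst (Matrix.transvection b a 1) P) =
      Ideal.Quotient.mk (frobIdeal F n 2) P

variable {P : MvPolynomial (Fin n) F}

theorem IsReduced.le_of_coeff_ne_zero (hP : IsReduced P) {i : Fin n → ℕ}
    (h : coeff (expo F i) P ≠ 0) (j : Fin n) : i j ≤ q + 1 := by
  obtain ⟨i', hi', h'⟩ := hP.supp _ h
  rw [expo_injective h']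
  exact hi' j

theorem coeff_slice_mul (P : MvPolynomial (Fin n) F) {a b : Fin n} (hab : a ≠ b) (i : Fin n → ℕ)
    {r s : ℕ} (hr : r ≤ s) :
    (slice a b (expo F (setPair i a b 0 0)) (s * (q - 1)) P).coeff (r * (q - 1)) =
      coeff (expo F (setPair i a b r (s - r))) P := by
  have e : s * (q - 1) = r * (q - 1) + (s - r) * (q - 1) := by
    rw [← add_mul, Nat.add_sub_cancel' hr]
  rw [e, coeff_slice_add hab, expo_setPair i hab]
  · rw [expo_apply, setPair_left _ hab, zero_mul]
  · rw [expo_apply, setPair_right, zero_mul]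

theorem exists_of_coeff_slice_ne_zero
    (hP : ∀ d, coeff d P ≠ 0 → ∃ i, (∀ j, i j ≤ q + 1) ∧ d = expo F i) {a b : Fin n} (hab : a ≠ b)
    {i : Fin n → ℕ} {s u : ℕ}
    (h : (slice a b (expo F (setPair i a b 0 0)) (s * (q - 1)) P).coeff u ≠ 0) :
    ∃ r ≤ s, u = r * (q - 1) ∧ coeff (expo F (setPair i a b r (s - r))) P ≠ 0 := by
  have hq : 1 < q := Fintype.one_lt_card
  have ha : expo F (setPair i a b 0 0) a = 0 := by rw [expo_apply, setPair_left _ hab, zero_mul]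
  have hb : expo F (setPair i a b 0 0) b = 0 := by rw [expo_apply, setPair_right, zero_mul]
  have hu : u ≤ s * (q - 1) := by
    by_contra! hlt
    exact h (coeff_slice_of_lt P hb hlt)
  have hne := h
  rw [← Nat.add_sub_cancel' hu, coeff_slice_add hab _ ha hb] at hne
  obtain ⟨i', hi', he⟩ := hP _ hne
  have := DFunLike.congr_fun he a
  simp only [Finsupp.add_apply, Finsupp.single_eq_same, ha, Finsupp.single_eq_of_ne hab,
    expo_apply, zero_add, add_zero] at this
  subst this
  have hr : i' a ≤ s := Nat.le_of_mul_le_mul_right hu (by omega)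
  exact ⟨i' a, hr, rfl, by rwa [← coeff_slice_mul P hab i hr]⟩

theorem IsReduced.coeff_shiftDiff_slice (hP : IsReduced P) {a b : Fin n} (hab : a ≠ b)
    {i : Fin n → ℕ} (hi : ∀ j, i j ≤ q + 1) {s : ℕ} :
    ∀ u < q ^ 2, ∀ v < q ^ 2, u + v = s * (q - 1) →
      (shiftDiff (slice a b (expo F (setPair i a b 0 0)) (s * (q - 1)) P)).coeff u = 0 := by
  intro u hu v hv huv
  rw [← huv]
  refine (mk_linSubst_transvection_iff hab P).1 (hP.inv a b hab) _ ?_ ?_ ?_ u hu v hv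
  · rw [expo_apply, setPair_left _ hab, zero_mul]
  · rw [expo_apply, setPair_right, zero_mul]
  · intro j
    rw [expo_apply, mul_card_sub_one_lt_iff]
    exact setPair_le hab hi (Nat.zero_le _) (Nat.zero_le _) j

theorem IsReduced.eq_top_of_eq_top (hP : IsReduced P) {i : Fin n → ℕ}
    (h : coeff (expo F i) P ≠ 0) {a : Fin n} (ha : i a = q + 1) (b : Fin n) : i b = q + 1 := by
  by_contra hb
  have hab : a ≠ b := by rintro rfl; exact hb ha
  have hi := hP.le_of_coeff_ne_zero h
  have hib := hi b
  have := coeff_top_eq_zero_of_shiftDiff (s := i a + i b) (by omega) (fun u hu => ?_)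
    (hP.coeff_shiftDiff_slice hab hi)
  · rw [coeff_slice_mul P hab i (by omega), ← ha, Nat.add_sub_cancel_left, setPair_self] at this
    exact h this
  · obtain ⟨r, hr, rfl, hne⟩ := exists_of_coeff_slice_ne_zero hP.supp hab hu
    have := hP.le_of_coeff_ne_zero hne a
    rw [setPair_left _ hab] at this
    exact ⟨r, hr, rfl, this⟩

theorem IsReduced.le_card_of_coeff_ne_zero (hP : IsReduced P) {i : Fin n → ℕ}
    (h : coeff (expo F i) P ≠ 0) {a b : Fin n} (hs : i a + i b ≤ 2 * q + 1) (j : Fin n) :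
    i j ≤ q := by
  by_contra! hj
  have h1 := hP.le_of_coeff_ne_zero h j
  have hj' : i j = q + 1 := by omega
  have := hP.eq_top_of_eq_top h hj' a
  have := hP.eq_top_of_eq_top h hj' b
  omega

theorem IsReduced.coeff_eq_zero_of_add_lt (hP : IsReduced P) {i : Fin n → ℕ} {a b : Fin n}
    (hab : a ≠ b) (h0 : 1 ≤ i a + i b) (hs : i a + i b < q) : coeff (expo F i) P = 0 := by
  -- The one-variable relation says nothing about exponent 0, so a nonzero entry of the pair is put
  -- first.
  wlog ha : 1 ≤ i a generalizing a b
  · exact this hab.symm (by omega) (by omega) (by omega)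
  by_contra h
  have hi := hP.le_of_coeff_ne_zero h
  have := coeff_eq_zero_of_lt_of_shiftDiff hs (fun u hu => ?_)
    (hP.coeff_shiftDiff_slice hab hi) ha
  · rw [coeff_slice_mul P hab i (by omega), Nat.add_sub_cancel_left, setPair_self] at this
    exact h this
  · obtain ⟨r, hr, rfl, hne⟩ := exists_of_coeff_slice_ne_zero hP.supp hab hu
    exact ⟨r, hr, rfl⟩

theorem IsReduced.coeff_eq_of_one_le (hP : IsReduced P) {i : Fin n → ℕ}
    (hi : ∀ j, i j ≤ q) {a b : Fin n} (hab : a ≠ b) (hs : q ≤ i a + i b) (ha : 1 ≤ i a) :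
    coeff (expo F i) P = coeff (expo F (setPair i a b q (i a + i b - q))) P := by
  have h1 := hi a
  have h2 := hi b
  have := coeff_eq_of_le_of_shiftDiff hs (by omega) (fun u hu => ?_)
    (hP.coeff_shiftDiff_slice hab (fun j => (hi j).trans (Nat.le_succ _))) ha (by omega) h1
  · rwa [coeff_slice_mul P hab i (by omega), coeff_slice_mul P hab i hs, Nat.add_sub_cancel_left,
      setPair_self] at this
  · obtain ⟨r, hr, rfl, hne⟩ := exists_of_coeff_slice_ne_zero hP.supp hab hu
    -- The pair sum is at most `2q` throughout the slice, while an entry `q + 1` would force it to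
    -- be `2q + 2`.
    have hle := hP.le_card_of_coeff_ne_zero (a := a) (b := b) hne
      (by rw [setPair_left _ hab, setPair_right]; omega)
    have ha' := hle a
    have hb' := hle b
    rw [setPair_left _ hab] at ha'
    rw [setPair_right] at hb'
    exact ⟨r, hr, rfl, ha', by omega⟩

theorem IsReduced.coeff_eq_setPair (hP : IsReduced P) {i : Fin n → ℕ}
    (hi : ∀ j, i j ≤ q) {a b : Fin n} (hab : a ≠ b) (hs : q ≤ i a + i b) :
    coeff (expo F i) P = coeff (expo F (setPair i a b q (i a + i b - q))) P := by
  have hq : 1 < q := Fintype.one_lt_card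
  rcases Nat.eq_zero_or_pos (i a) with ha | ha
  · have hb : i b = q := le_antisymm (hi b) (by omega)
    -- The pair is `(0, q)`, whose first entry is invisible to the one-variable relation. The pair
    -- `(q - 1, 1)` has both entries positive, so it can be compared with `(q, 0)` in one order and
    -- with `(0, q)` in the other.
    have hi' := setPair_le hab hi (r := q - 1) (t := 1) (by omega) (by omega)
    have h1 := hP.coeff_eq_of_one_le hi' hab
      (by rw [setPair_left _ hab, setPair_right]; omega)
      (by rw [setPair_left _ hab]; omega)
    have h2 := hP.coeff_eq_of_one_le hi' hab.symm
      (by rw [setPair_left _ hab, setPair_right]; omega)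
      (by rw [setPair_right])
    rw [setPair_left _ hab, setPair_right, setPair_setPair _ hab] at h1
    rw [setPair_left _ hab, setPair_right, setPair_swap _ hab.symm, setPair_setPair _ hab] at h2
    rw [show q - 1 + 1 - q = i a + i b - q by omega] at h1
    rw [show 1 + (q - 1) - q = i a by omega, ← hb, setPair_self] at h2
    rw [← h1, ← h2, hb]
  · exact hP.coeff_eq_of_one_le hi hab hs ha

end PairRelations

/-! ### Moving exponents to a corner vector. -/

section Corner

open MvPolynomial

variable {n : ℕ}

theorem sum_eq_pair_add {a b : Fin n} (hab : a ≠ b) (i : Fin n → ℕ) :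
    ∑ j, i j = i a + i b + ∑ j ∈ (Finset.univ.erase a).erase b, i j := by
  rw [← Finset.add_sum_erase _ _ (Finset.mem_univ a), add_assoc,
    Finset.add_sum_erase _ _ (Finset.mem_erase.2 ⟨hab.symm, Finset.mem_univ b⟩)]

theorem sum_setPair {a b : Fin n} (hab : a ≠ b) (i : Fin n → ℕ) {r t : ℕ}
    (h : r + t = i a + i b) : ∑ j, setPair i a b r t j = ∑ j, i j := by
  rw [sum_eq_pair_add hab, sum_eq_pair_add hab i, setPair_left _ hab, setPair_right, h]
  congr 1
  refine Finset.sum_congr rfl fun j hj => ?_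
  rw [Finset.mem_erase, Finset.mem_erase] at hj
  exact setPair_of_ne _ _ _ hj.2.1 hj.1

/-- The other `n - 2` entries account for at most `(n - 2) * M` of the sum. -/
theorem le_pair_of_le_sum {a b : Fin n} (hab : a ≠ b) {i : Fin n → ℕ} {M : ℕ}
    (hi : ∀ j, i j ≤ M) (h : (n - 1) * M ≤ ∑ j, i j) : M ≤ i a + i b := by
  have h1 : ∑ j ∈ (Finset.univ.erase a).erase b, i j ≤ (n - 2) * M := by
    refine (Finset.sum_le_card_nsmul _ _ M fun j _ => hi j).trans_eq ?_
    rw [Finset.card_erase_of_mem (Finset.mem_erase.2 ⟨hab.symm, Finset.mem_univ b⟩),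
      Finset.card_erase_of_mem (Finset.mem_univ a), Finset.card_univ, Fintype.card_fin,
      smul_eq_mul, Nat.sub_sub]
  rw [sum_eq_pair_add hab] at h
  have hn : n - 1 = n - 2 + 1 := by
    have := a.isLt; have := b.isLt
    have : (a : ℕ) ≠ b := fun h => hab (Fin.ext h)
    omega
  rw [hn, add_mul, one_mul] at h
  omega

/-- The vector with entry `k` at `a` and all other entries `M`. -/
def corner (M : ℕ) (a : Fin n) (k : ℕ) : Fin n → ℕ := Function.update (fun _ => M) a k

theorem sum_corner (M : ℕ) (a : Fin n) (k : ℕ) : ∑ j, corner M a k j = (n - 1) * M + k := by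
  rw [corner, Finset.sum_update_of_mem (Finset.mem_univ a), Finset.sum_const,
    Finset.sdiff_singleton_eq_erase,
    Finset.card_erase_of_mem (Finset.mem_univ a), Finset.card_univ, Fintype.card_fin, smul_eq_mul,
    add_comm]

theorem corner_le {M k : ℕ} (hk : k ≤ M) (a j : Fin n) : corner M a k j ≤ M := by
  rw [corner, Function.update_apply]
  split_ifs
  exacts [hk, le_rfl]

theorem corner_ne_top {a : Fin n} {M k : ℕ} (hk : k ≤ M) :
    corner M a k ≠ fun _ => M + 1 := fun h => by
  have h1 := corner_le hk a a
  have h2 := congrFun h a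
  omega

variable {F : Type*} [Field F] [Fintype F]

local notation "q" => Fintype.card F

variable {P : MvPolynomial (Fin n) F}

/-- Filling up the coordinates other than `a` one after the other reduces every vector to a corner
vector, unless the coefficient vanishes on the way. -/
theorem IsReduced.coeff_eq_corner_or (hP : IsReduced P) (a : Fin n)
    {i : Fin n → ℕ} (hi : ∀ j, i j ≤ q) :
    (∃ k, ∑ j, i j = (n - 1) * q + k ∧ coeff (expo F i) P = coeff (expo F (corner q a k)) P) ∨
      (∑ j, i j < (n - 1) * q ∧ (i ≠ 0 → coeff (expo F i) P = 0)) := by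
  have hq : 1 < q := Fintype.one_lt_card
  -- Induction on the number of coordinates other than `a` that are not yet `q`. Filling one such
  -- `b` from `a` is possible when the pair sum is at least `q`.
  induction hN : (Finset.univ.filter fun j => j ≠ a ∧ i j ≠ q).card using Nat.strong_induction_on
    generalizing i with
  | _ N ih =>
    by_cases hfull : ∀ b, b ≠ a → i b = q
    · have hc : i = corner q a (i a) := by
        funext j
        rw [corner, Function.update_apply]
        split_ifs with hj
        exacts [congrArg i hj, hfull j hj]
      exact Or.inl ⟨i a, by rw [← sum_corner, ← hc], by rw [← hc]⟩
    push Not at hfull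
    obtain ⟨b, hba, hb⟩ := hfull
    rcases Nat.lt_or_ge (i b + i a) q with hs | hs
    · refine Or.inr ⟨?_, fun h0 => ?_⟩
      · by_contra! hle
        have := le_pair_of_le_sum hba hi hle
        omega
      rcases Nat.eq_zero_or_pos (i b + i a) with hz | hz
      · obtain ⟨c, hc⟩ := Function.ne_iff.1 h0
        rw [Pi.zero_apply] at hc
        have hca : c ≠ a := by rintro rfl; omega
        have hcb : c ≠ b := by rintro rfl; omega
        rcases (hi c).eq_or_lt with hcq | hcq
        · have hi' := setPair_le hca hi (r := 1) (t := q - 1) (by omega) (by omega)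
          have h1 := hP.coeff_eq_setPair hi hca (by omega)
          have h2 := hP.coeff_eq_setPair hi' hca
            (by rw [setPair_left _ hca, setPair_right]; omega)
          rw [setPair_left _ hca, setPair_right, setPair_setPair _ hca,
            show 1 + (q - 1) - q = i c + i a - q by omega, ← h1] at h2
          rw [← h2]
          refine hP.coeff_eq_zero_of_add_lt hcb ?_ ?_
          · rw [setPair_left _ hca]; omega
          · rw [setPair_left _ hca, setPair_of_ne _ _ _ hcb.symm hba]; omega
        · exact hP.coeff_eq_zero_of_add_lt hca (by omega) (by omega)
      · exact hP.coeff_eq_zero_of_add_lt hba hz hs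
    · have hia := hi a
      have hib := hi b
      have hcoeff := hP.coeff_eq_setPair hi hba hs
      have hsum := sum_setPair hba i (r := q) (t := i b + i a - q) (by omega)
      have hi' := setPair_le hba hi (r := q) (t := i b + i a - q) le_rfl (by omega)
      rw [hcoeff, ← hsum]
      have hlt : (Finset.univ.filter fun j =>
          j ≠ a ∧ setPair i b a q (i b + i a - q) j ≠ q).card < N := by
        rw [← hN]
        refine Finset.card_lt_card (Finset.ssubset_iff_of_subset ?_ |>.2 ⟨b, ?_, ?_⟩)
        · intro j hj
          rw [Finset.mem_filter] at hj ⊢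
          refine ⟨hj.1, hj.2.1, ?_⟩
          have hjb : j ≠ b := by
            rintro rfl
            exact hj.2.2 (setPair_left _ hba _ _)
          rw [setPair_of_ne _ _ _ hjb hj.2.1] at hj
          exact hj.2.2
        · simp [hba, hb]
        · simp [setPair_left _ hba]
      rcases ih _ hlt hi' rfl with h | h
      · exact Or.inl h
      · refine Or.inr ⟨h.1, fun _ => h.2 fun h0 => ?_⟩
        have := congrFun h0 b
        rw [setPair_left _ hba, Pi.zero_apply] at this
        omega

theorem IsReduced.coeff_eq_corner (hP : IsReduced P) (a : Fin n) {i : Fin n → ℕ}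
    (hi : ∀ j, i j ≤ q) {k : ℕ} (hk : ∑ j, i j = (n - 1) * q + k) :
    coeff (expo F i) P = coeff (expo F (corner q a k)) P := by
  rcases hP.coeff_eq_corner_or a hi with ⟨k', h1, h2⟩ | h
  · obtain rfl : k = k' := by omega
    exact h2
  · omega

theorem IsReduced.le_sum_of_coeff_ne_zero (hP : IsReduced P) {i : Fin n → ℕ}
    (hi : ∀ j, i j ≤ q) (h0 : i ≠ 0) (hne : coeff (expo F i) P ≠ 0) :
    (n - 1) * q ≤ ∑ j, i j := by
  obtain ⟨a, -⟩ := Function.ne_iff.1 h0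
  rcases hP.coeff_eq_corner_or a hi with ⟨k', h1, h2⟩ | h
  · omega
  · exact absurd (h.2 h0) hne

end Corner

/-! ### Reduced representatives, and invariance of `y_{n,k}` and `z_n`. -/

section Generators

open MvPolynomial

variable {F : Type*} [Field F] [Fintype F] {n : ℕ}

local notation "q" => Fintype.card F

/-- Truncation to the box: applied with `M = q ^ 2`, it gives a representative of a class of `Q`
with no superfluous monomials. -/
theorem exists_coeff_eq_ite {R : Type*} [CommSemiring R] (M : ℕ) (P : MvPolynomial (Fin n) R) :
    ∃ P' : MvPolynomial (Fin n) R, ∀ d, coeff d P' = if ∀ j, d j < M then coeff d P else 0 := by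
  refine ⟨∑ d ∈ P.support with ∀ j, d j < M, monomial d (coeff d P), fun d => ?_⟩
  rw [coeff_sum]
  simp only [coeff_monomial, Finset.sum_ite_eq', Finset.mem_filter, mem_support_iff]
  by_cases h1 : ∀ j, d j < M <;> by_cases h2 : coeff d P = 0 <;> simp [h1, h2]

theorem exists_isReduced_of_mem_invariants {f : Q F n 2} (hf : f ∈ invariants F n 2) :
    ∃ P, IsReduced P ∧ Ideal.Quotient.mk _ P = f := by
  obtain ⟨P₀, rfl⟩ := Ideal.Quotient.mk_surjective f
  obtain ⟨P, hP⟩ := exists_coeff_eq_ite (q ^ 2) P₀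
  have hmk : Ideal.Quotient.mk (frobIdeal F n 2) P = Ideal.Quotient.mk _ P₀ :=
    (mk_eq_mk_iff _ _).2 fun d hd => by rw [hP, if_pos hd]
  rw [← hmk, mk_mem_invariants_iff] at hf
  refine ⟨P, ⟨fun d hd => ?_, hf.2⟩, hmk⟩
  have hbox : ∀ j, d j < q ^ 2 := by
    by_contra h
    exact hd (by rw [hP, if_neg h])
  choose i hi using hf.1 d hbox hd
  refine ⟨i, fun j => ?_, Finsupp.ext fun j => ?_⟩
  · rw [← mul_card_sub_one_lt_iff F, mul_comm, ← hi]; exact hbox j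
  · rw [expo_apply, hi, mul_comm]

theorem IsReduced.mem_invariants {P : MvPolynomial (Fin n) F} (hP : IsReduced P) :
    Ideal.Quotient.mk _ P ∈ invariants F n 2 := by
  refine (mk_mem_invariants_iff P).2 ⟨fun d _ hne j => ?_, hP.inv⟩
  obtain ⟨i, -, rfl⟩ := hP.supp d hne
  exact Dvd.intro_left _ rfl

theorem prod_X_pow_eq_monomial_expo (i : Fin n → ℕ) :
    ∏ j, (X j : MvPolynomial (Fin n) F) ^ (i j * (q - 1)) = monomial (expo F i) 1 := by
  rw [monomial_eq, C_1, one_mul, Finsupp.prod_fintype _ _ fun _ => pow_zero _]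
  rfl

theorem zPoly_eq_monomial : zPoly F n = monomial (expo F fun _ => q + 1) 1 := by
  rw [← prod_X_pow_eq_monomial_expo, zPoly, card_sq_sub_one]

theorem yPoly_eq_sum_monomial (k : ℕ) :
    yPoly F n k = ∑ i : Fin n → Fin (q + 1) with ∑ j, (i j : ℕ) = (n - 1) * q + k,
      monomial (expo F fun j => (i j : ℕ)) 1 := by
  simp only [← prod_X_pow_eq_monomial_expo, yPoly]

theorem coeff_expo_zPoly (i : Fin n → ℕ) :
    coeff (expo F i) (zPoly F n) = if i = fun _ => q + 1 then 1 else 0 := by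
  rw [zPoly_eq_monomial, coeff_monomial]
  simp only [expo_injective.eq_iff, eq_comm]

theorem coeff_expo_yPoly (k : ℕ) (i : Fin n → ℕ) :
    coeff (expo F i) (yPoly F n k) =
      if (∀ j, i j ≤ q) ∧ ∑ j, i j = (n - 1) * q + k then 1 else 0 := by
  rw [yPoly_eq_sum_monomial, coeff_sum]
  simp only [coeff_monomial, expo_injective.eq_iff]
  split_ifs with h
  · let i' : Fin n → Fin (q + 1) := fun j => ⟨i j, Nat.lt_succ_of_le (h.1 j)⟩
    rw [Finset.sum_eq_single_of_mem i']
    · exact if_pos rfl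
    · rw [Finset.mem_filter]; exact ⟨Finset.mem_univ _, h.2⟩
    · intro b _ hb
      refine if_neg fun hbi => hb ?_
      funext j
      exact Fin.ext (congrFun hbi j)
  · refine Finset.sum_eq_zero fun b hb => if_neg fun hbi => h ?_
    rw [Finset.mem_filter] at hb
    subst hbi
    exact ⟨fun j => Nat.le_of_lt_succ (b j).isLt, hb.2⟩

theorem exists_of_coeff_yPoly_ne_zero {k : ℕ} {d : Fin n →₀ ℕ} (h : coeff d (yPoly F n k) ≠ 0) :
    ∃ i : Fin n → ℕ, (∀ j, i j ≤ q) ∧ ∑ j, i j = (n - 1) * q + k ∧ d = expo F i := by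
  rw [yPoly_eq_sum_monomial, coeff_sum] at h
  obtain ⟨i, hi, hne⟩ := Finset.exists_ne_zero_of_sum_ne_zero h
  rw [coeff_monomial] at hne
  exact ⟨fun j => i j, fun j => Nat.le_of_lt_succ (i j).isLt, (Finset.mem_filter.1 hi).2,
    by_contra fun h => hne (if_neg (Ne.symm h))⟩

theorem yPoly_supp (k : ℕ) (d : Fin n →₀ ℕ) (h : coeff d (yPoly F n k) ≠ 0) :
    ∃ i, (∀ j, i j ≤ q + 1) ∧ d = expo F i := by
  obtain ⟨i, hi, -, hd⟩ := exists_of_coeff_yPoly_ne_zero h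
  exact ⟨i, fun j => (hi j).trans (Nat.le_succ _), hd⟩

theorem zPoly_supp (d : Fin n →₀ ℕ) (h : coeff d (zPoly F n) ≠ 0) :
    ∃ i, (∀ j, i j ≤ q + 1) ∧ d = expo F i := by
  rw [zPoly_eq_monomial, coeff_monomial] at h
  exact ⟨fun _ => q + 1, fun _ => le_rfl, by_contra fun h' => h (if_neg (Ne.symm h'))⟩

/-- A slice of a polynomial in the `x_j ^ (q - 1)` is zero or comes from a monomial of it. -/
theorem slice_eq_zero_or {P : MvPolynomial (Fin n) F}
    (hP : ∀ d, coeff d P ≠ 0 → ∃ i, (∀ j, i j ≤ q + 1) ∧ d = expo F i) {a b : Fin n}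
    (hab : a ≠ b) {d : Fin n →₀ ℕ} (ha : d a = 0) (hb : d b = 0) (N : ℕ) :
    slice a b d N P = 0 ∨ ∃ i, coeff (expo F i) P ≠ 0 ∧ d = expo F (setPair i a b 0 0) ∧
      N = (i a + i b) * (q - 1) := by
  refine or_iff_not_imp_left.2 fun h0 => ?_
  obtain ⟨u, hu⟩ : ∃ u, (slice a b d N P).coeff u ≠ 0 := by
    by_contra! h
    exact h0 (Polynomial.ext fun u => by rw [h, Polynomial.coeff_zero])
  have huN : u ≤ N := by
    by_contra! hlt
    exact hu (coeff_slice_of_lt P hb hlt)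
  obtain ⟨v, rfl⟩ := Nat.exists_eq_add_of_le huN
  rw [coeff_slice_add hab _ ha hb] at hu
  obtain ⟨i, -, he⟩ := hP _ hu
  rw [he] at hu
  have hj := DFunLike.congr_fun he
  simp only [Finsupp.add_apply, expo_apply] at hj
  refine ⟨i, hu, Finsupp.ext fun j => ?_, ?_⟩
  · rw [expo_apply]
    by_cases hja : j = a
    · subst hja; rw [setPair_left _ hab, ha, zero_mul]
    · by_cases hjb : j = b
      · subst hjb; rw [setPair_right, hb, zero_mul]
      · rw [setPair_of_ne _ _ _ hja hjb, ← hj j]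
        simp [hja, hjb]
  · have h1 := hj a
    have h2 := hj b
    simp only [ha, hb, Finsupp.single_eq_same, Finsupp.single_eq_of_ne hab,
      Finsupp.single_eq_of_ne hab.symm, zero_add, add_zero] at h1 h2
    rw [h1, h2, add_mul]

theorem isReduced_zPoly : IsReduced (zPoly F n) := by
  refine ⟨zPoly_supp, fun a b hab => ?_⟩
  rw [mk_linSubst_transvection_iff hab]
  intro d ha hb hd u hu v hv
  rcases slice_eq_zero_or (zPoly_supp (F := F)) hab ha hb (u + v) with h | ⟨i, hi, hdi, hN⟩
  · rw [h, map_zero, Polynomial.coeff_zero]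
  · rw [coeff_expo_zPoly] at hi
    obtain rfl : i = fun _ => q + 1 := by_contra fun h => hi (if_neg h)
    have hq2 : 0 < q ^ 2 := pow_pos Fintype.card_pos 2
    rw [add_mul, card_sq_sub_one] at hN
    -- Since `u + v = 2 (q ^ 2 - 1)` with both below `q ^ 2`, necessarily `u = q ^ 2 - 1`, and the
    -- slice has degree at most `u`.
    refine coeff_shiftDiff_of_natDegree_le (Polynomial.natDegree_le_iff_coeff_eq_zero.2 ?_)
    intro w hw
    by_contra hne
    rw [hN, ← card_sq_sub_one, ← add_mul, hdi] at hne
    obtain ⟨r, -, rfl, hr⟩ := exists_of_coeff_slice_ne_zero zPoly_supp hab hne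
    rw [coeff_expo_zPoly] at hr
    have := congrFun (by_contra fun h => hr (if_neg h) : _ = fun _ : Fin n => q + 1) a
    rw [setPair_left _ hab] at this
    have := (mul_card_sub_one_lt_iff F r).2 this.le
    omega

/-- With the other entries and `s = i a + i b` fixed, the entry at `a` ranges over `s - q ≤ r ≤ q`,
every coefficient being 1. -/
theorem slice_yPoly {a b : Fin n} (hab : a ≠ b) {i : Fin n → ℕ} (hi : ∀ j, i j ≤ q) {k : ℕ}
    (hk : ∑ j, i j = (n - 1) * q + k) :
    slice a b (expo F (setPair i a b 0 0)) ((i a + i b) * (q - 1)) (yPoly F n k) =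
      geomPoly F (i a + i b - q) := by
  have hs : q ≤ i a + i b := le_pair_of_le_sum hab hi (by omega)
  have key : ∀ r, (slice a b (expo F (setPair i a b 0 0)) ((i a + i b) * (q - 1))
      (yPoly F n k)).coeff (r * (q - 1)) = (geomPoly F (i a + i b - q)).coeff (r * (q - 1)) := by
    intro r
    rw [coeff_geomPoly]
    rcases Nat.lt_or_ge (i a + i b) r with hr | hr
    · rw [if_neg (by omega)]
      by_contra hne
      obtain ⟨r', hr', he, -⟩ := exists_of_coeff_slice_ne_zero (yPoly_supp k) hab hne
      rw [mul_card_sub_one_inj] at he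
      omega
    · rw [coeff_slice_mul _ hab _ hr, coeff_expo_yPoly]
      refine if_congr ⟨fun h => ?_, fun h => ⟨?_, ?_⟩⟩ rfl rfl
      · have h1 := h.1 a
        have h2 := h.1 b
        rw [setPair_left _ hab] at h1
        rw [setPair_right] at h2
        omega
      · exact setPair_le hab hi h.2 (by omega)
      · rw [sum_setPair hab _ (by omega), hk]
  ext u
  by_cases hu : ∃ r, u = r * (q - 1)
  · obtain ⟨r, rfl⟩ := hu
    exact key r
  · have h1 : (geomPoly F (i a + i b - q)).coeff u = 0 := by
      by_contra hne
      obtain ⟨r, -, -, hr⟩ := exists_of_coeff_geomPoly_ne_zero hne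
      exact hu ⟨r, hr⟩
    rw [h1]
    by_contra hne
    obtain ⟨r, -, hr, -⟩ := exists_of_coeff_slice_ne_zero (yPoly_supp k) hab hne
    exact hu ⟨r, hr⟩

theorem isReduced_yPoly (k : ℕ) : IsReduced (yPoly F n k) := by
  refine ⟨yPoly_supp k, fun a b hab => ?_⟩
  rw [mk_linSubst_transvection_iff hab]
  intro d ha hb hd u hu v hv
  rcases slice_eq_zero_or (yPoly_supp (F := F) k) hab ha hb (u + v) with h | ⟨i, hi, hdi, hN⟩
  · rw [h, map_zero, Polynomial.coeff_zero]
  · rw [coeff_expo_yPoly] at hi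
    have hi' := by_contra fun h => hi (if_neg h)
    have hs : q ≤ i a + i b := le_pair_of_le_sum hab hi'.1 (by omega)
    have h1 := hi'.1 a
    have h2 := hi'.1 b
    rw [hN, hdi, slice_yPoly hab hi'.1 hi'.2]
    -- The degree bound needed is exactly `v < q ^ 2`, rewritten through `u + v = s (q - 1)`.
    refine coeff_shiftDiff_geomPoly (by omega) ?_
    obtain ⟨t, ht⟩ := Nat.exists_eq_add_of_le hs
    rw [ht, add_mul] at hN
    rw [ht, Nat.add_sub_cancel_left]
    have : q * (q - 1) + q = q ^ 2 := by
      rw [← Nat.mul_succ, Nat.succ_eq_add_one, Nat.sub_add_cancel Fintype.card_pos, pow_two]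
    omega

end Generators

/-! ### Bases and graded dimensions from dual functionals. -/

section DualBasis

variable {K V ι : Type*} [Field K] [AddCommGroup V] [Module K V] [Fintype ι] [DecidableEq ι]

theorem exists_basis_of_dual (S : Submodule K V) (v : ι → V) (φ : ι → V →ₗ[K] K)
    (hv : ∀ i, v i ∈ S) (hφ : ∀ i j, φ i (v j) = if i = j then 1 else 0)
    (hspan : ∀ f ∈ S, f = ∑ i, φ i f • v i) :
    ∃ b : Module.Basis ι K S, ∀ i, (b i : V) = v i := by
  let e : S ≃ₗ[K] (ι → K) := LinearEquiv.ofLinearMap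
    (LinearMap.pi fun i => (φ i).comp S.subtype)
    ((Fintype.linearCombination K v).codRestrict S fun c => by
      rw [Fintype.linearCombination_apply]
      exact S.sum_mem fun i _ => S.smul_mem _ (hv i))
    (by
      ext c i
      simp [hφ, Pi.single_apply, eq_comm])
    (by
      ext f
      simpa [Fintype.linearCombination_apply] using (hspan f f.2).symm)
  refine ⟨Module.Basis.ofEquivFun e, fun i => ?_⟩
  rw [Module.Basis.coe_ofEquivFun]
  change Fintype.linearCombination K v (Pi.single i 1) = v i
  rw [Fintype.linearCombination_apply_single, one_smul]

/-- The functionals outside `p` vanish on `W`, so the expansion of an element of `S ⊓ W` involves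
only the `v i` with `p i`. With `W` a graded piece this counts the generators of one degree. -/
theorem finrank_inf_of_dual (S : Submodule K V) (v : ι → V) (φ : ι → V →ₗ[K] K)
    (hv : ∀ i, v i ∈ S) (hφ : ∀ i j, φ i (v j) = if i = j then 1 else 0)
    (hspan : ∀ f ∈ S, f = ∑ i, φ i f • v i) (W : Submodule K V) (p : ι → Prop)
    [DecidablePred p] (hW : ∀ i, p i → v i ∈ W) (hφW : ∀ i, ¬ p i → ∀ f ∈ W, φ i f = 0) :
    Module.finrank K ↥(S ⊓ W) = Fintype.card {i // p i} := by
  obtain ⟨b, -⟩ := exists_basis_of_dual (S ⊓ W) (fun i : {i // p i} => v i) (fun i => φ i)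
    (fun i => ⟨hv i, hW i i.2⟩) (fun i j => by simp only [hφ, Subtype.ext_iff])
    (fun f hf => by
      conv_lhs => rw [hspan f hf.1]
      rw [← Finset.sum_filter_of_ne (p := p) fun i _ hne => by_contra fun hi =>
        hne (by rw [hφW i hi f hf.2, zero_smul])]
      exact Finset.sum_subtype _ (by simp) _)
  exact Module.finrank_eq_card_basis b

end DualBasis

/-! ### Coefficient functionals on `Q` and the Hilbert series. -/

section Functionals

open MvPolynomial

variable {F : Type*} [Field F] [Fintype F] {n : ℕ}

local notation "q" => Fintype.card F

/-- The coefficient of a monomial of `Q`, for an exponent vector in the box. -/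
noncomputable def coeffQ {m : ℕ} (d : Fin n →₀ ℕ) (hd : ∀ j, d j < q ^ m) : Q F n m →ₗ[F] F where
  toFun f := coeff d (Function.surjInv Ideal.Quotient.mk_surjective f)
  map_add' f g := by
    rw [← coeff_add]
    refine (mk_eq_mk_iff _ _).1 ?_ d hd
    rw [map_add]
    simp only [Function.surjInv_eq]
  map_smul' c f := by
    rw [RingHom.id_apply, ← coeff_smul]
    refine (mk_eq_mk_iff _ _).1 ?_ d hd
    exact (Function.surjInv_eq _ _).trans
      (congrArg (c • ·) (Function.surjInv_eq Ideal.Quotient.mk_surjective f).symm)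

theorem coeffQ_mk {m : ℕ} {d : Fin n →₀ ℕ} (hd : ∀ j, d j < q ^ m) (P : MvPolynomial (Fin n) F) :
    coeffQ d hd (Ideal.Quotient.mk _ P) = coeff d P := by
  refine (mk_eq_mk_iff _ _).1 ?_ d hd
  exact Function.surjInv_eq _ _

theorem coeffQ_eq_zero_of_mem_degreePart {m : ℕ} {d : Fin n →₀ ℕ} (hd : ∀ j, d j < q ^ m)
    {D : ℕ} (hD : d.degree ≠ D) {f : Q F n m} (hf : f ∈ degreePart F n m D) :
    coeffQ d hd f = 0 := by
  obtain ⟨P, hP, rfl⟩ := hf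
  change coeffQ d hd (Ideal.Quotient.mk _ P) = 0
  rw [coeffQ_mk]
  exact IsHomogeneous.coeff_eq_zero hP hD

theorem mk_mem_degreePart {m D : ℕ} {P : MvPolynomial (Fin n) F} (hP : P.IsHomogeneous D) :
    Ideal.Quotient.mk _ P ∈ degreePart F n m D := ⟨P, hP, rfl⟩

/-- Homogeneous polynomials dual to coefficients on the invariants give a basis of `Q^G` and its
Hilbert series. -/
theorem hilbertSeries_and_basis_of_dual {ι : Type*} [Fintype ι] [DecidableEq ι]
    (v : ι → MvPolynomial (Fin n) F) (δ : ι → Fin n → ℕ)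
    (hδ : ∀ i j, δ i j ≤ q + 1) (hv : ∀ i, Ideal.Quotient.mk _ (v i) ∈ invariants F n 2)
    (hhom : ∀ i, (v i).IsHomogeneous ((∑ j, δ i j) * (q - 1)))
    (hdual : ∀ i i', coeff (expo F (δ i)) (v i') = if i = i' then 1 else 0)
    (hspan : ∀ P, IsReduced P → ∀ i : Fin n → ℕ,
      coeff (expo F i) P = ∑ k, coeff (expo F (δ k)) P * coeff (expo F i) (v k))
    (hsupp : ∀ k d, coeff d (v k) ≠ 0 → ∃ i, d = expo F i) :
    hilbertSeries F n 2 = ∑ i, PowerSeries.X ^ ((∑ j, δ i j) * (q - 1)) ∧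
    ∃ b : Module.Basis ι F (invariants F n 2), ∀ i, (b i : Q F n 2) = Ideal.Quotient.mk _ (v i) := by
  have hbox : ∀ i j, expo F (δ i) j < q ^ 2 := fun i j =>
    (mul_card_sub_one_lt_iff F _).2 (hδ i j)
  let S := Subalgebra.toSubmodule (invariants F n 2)
  let φ : ι → Q F n 2 →ₗ[F] F := fun i => coeffQ (expo F (δ i)) (hbox i)
  let w : ι → Q F n 2 := fun i => Ideal.Quotient.mk _ (v i)
  have hφ : ∀ i j, φ i (w j) = if i = j then 1 else 0 := fun i j => by
    rw [← hdual]; exact coeffQ_mk (hbox i) (v j)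
  have hspan' : ∀ f ∈ S, f = ∑ i, φ i f • w i := by
    intro f hf
    obtain ⟨P, hP, rfl⟩ := exists_isReduced_of_mem_invariants hf
    have : ∑ i, φ i (Ideal.Quotient.mk _ P) • w i =
        Ideal.Quotient.mk (frobIdeal F n 2) (∑ i, coeff (expo F (δ i)) P • v i) := by
      rw [map_sum]
      refine Finset.sum_congr rfl fun i _ => ?_
      rw [show φ i (Ideal.Quotient.mk _ P) = _ from coeffQ_mk (hbox i) P]
      rfl
    rw [this]
    refine (mk_eq_mk_iff _ _).2 fun d _ => ?_
    simp only [coeff_sum, coeff_smul, smul_eq_mul]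
    by_cases hd : ∃ i, d = expo F i
    · obtain ⟨i, rfl⟩ := hd
      exact hspan P hP i
    · have h1 : coeff d P = 0 := by
        by_contra hne
        obtain ⟨i, -, hi⟩ := hP.supp d hne
        exact hd ⟨i, hi⟩
      rw [h1, eq_comm]
      refine Finset.sum_eq_zero fun k _ => ?_
      rw [by_contra fun hne => hd (hsupp k d hne), mul_zero]
  constructor
  · ext D
    have := finrank_inf_of_dual S w φ hv hφ hspan' (degreePart F n 2 D)
      (fun i => (∑ j, δ i j) * (q - 1) = D)
      (fun i hi => mk_mem_degreePart (hi ▸ hhom i))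
      (fun i hi f hf => coeffQ_eq_zero_of_mem_degreePart (hbox i) (by rwa [degree_expo]) hf)
    rw [hilbertSeries, PowerSeries.coeff_mk, this, Fintype.card_subtype, map_sum]
    simp only [PowerSeries.coeff_X_pow, Finset.sum_boole, eq_comm]
  · exact exists_basis_of_dual S w φ hv hφ hspan'

end Functionals

/-! ### Basis and Hilbert series of the invariant ring. -/

section Main

open MvPolynomial

variable {F : Type*} [Field F] [Fintype F] {n : ℕ}

local notation "q" => Fintype.card F

theorem coeff_expo_one (i : Fin n → ℕ) :
    coeff (expo F i) (1 : MvPolynomial (Fin n) F) = if i = 0 then 1 else 0 := by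
  rw [coeff_one, ← expo_zero (F := F)]
  simp only [expo_injective.eq_iff, eq_comm]

theorem isHomogeneous_yPoly (k : ℕ) :
    (yPoly F n k).IsHomogeneous (((n - 1) * q + k) * (q - 1)) := by
  rw [yPoly_eq_sum_monomial]
  refine IsHomogeneous.sum _ _ _ fun i hi => isHomogeneous_monomial _ ?_
  rw [degree_expo, (Finset.mem_filter.1 hi).2]

theorem isHomogeneous_zPoly : (zPoly F n).IsHomogeneous ((∑ _j : Fin n, (q + 1)) * (q - 1)) := by
  rw [zPoly_eq_monomial]
  exact isHomogeneous_monomial _ (degree_expo _)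

theorem coeff_corner_yPoly {a : Fin n} {k k' : ℕ} (hk : k ≤ q) :
    coeff (expo F (corner q a k)) (yPoly F n k') = if k = k' then 1 else 0 := by
  rw [coeff_expo_yPoly, sum_corner]
  refine if_congr ⟨fun h => by omega, fun h => ⟨corner_le hk a, by omega⟩⟩ rfl rfl

theorem coeff_top_yPoly (a : Fin n) (k : ℕ) :
    coeff (expo F fun _ => q + 1) (yPoly F n k) = 0 := by
  rw [coeff_expo_yPoly, if_neg]
  intro h
  have := h.1 a
  omega

/-- Coefficientwise form of the spanning statement. The zero exponent must be left out when `n ≥ 2`,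
where the constant 1 is a separate generator; for `n = 1` it is the corner with `k = 0`. -/
theorem IsReduced.coeff_expo {P : MvPolynomial (Fin n) F} (hP : IsReduced P) (a : Fin n)
    {i : Fin n → ℕ} (hi : i ≠ 0 ∨ n = 1) :
    coeff (expo F i) P =
      ∑ k : Fin (q + 1), coeff (expo F (corner q a k)) P * coeff (expo F i) (yPoly F n k) +
        coeff (expo F fun _ => q + 1) P * coeff (expo F i) (zPoly F n) := by
  by_cases htop : i = fun _ => q + 1
  · subst htop
    simp only [coeff_top_yPoly a, coeff_expo_zPoly, mul_zero, Finset.sum_const_zero, zero_add,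
      if_true, mul_one]
  rw [coeff_expo_zPoly, if_neg htop, mul_zero, add_zero]
  by_cases hle : (∀ j, i j ≤ q) ∧ (n - 1) * q ≤ ∑ j, i j
  · obtain ⟨hle, hsum⟩ := hle
    obtain ⟨k, hk⟩ := Nat.exists_eq_add_of_le hsum
    have hkq : k ≤ q := by
      have h1 : ∑ j, i j ≤ n * q := by
        simpa using Finset.sum_le_card_nsmul Finset.univ i q fun j _ => hle j
      have h2 : n * q = (n - 1) * q + q := by
        rw [← Nat.succ_mul, Nat.succ_eq_add_one, Nat.sub_add_cancel a.pos]
      omega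
    rw [Finset.sum_eq_single_of_mem (⟨k, Nat.lt_succ_of_le hkq⟩ : Fin (q + 1)) (Finset.mem_univ _),
      coeff_expo_yPoly, if_pos ⟨hle, hk⟩, mul_one]
    · exact hP.coeff_eq_corner a hle hk
    · intro k' _ hk'
      rw [coeff_expo_yPoly, if_neg, mul_zero]
      rintro ⟨-, h⟩
      exact hk' (Fin.ext (by simp only; omega))
  · rw [Finset.sum_eq_zero]
    · by_contra hne
      have hle' : ∀ j, i j ≤ q := by
        by_contra! hj
        obtain ⟨j, hj⟩ := hj
        have hj' : i j = q + 1 := le_antisymm (hP.le_of_coeff_ne_zero hne j) hj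
        exact htop (funext (hP.eq_top_of_eq_top hne hj'))
      refine hle ⟨hle', ?_⟩
      rcases hi with h0 | h1
      · exact hP.le_sum_of_coeff_ne_zero hle' h0 hne
      · subst h1; simp
    · intro k _
      rw [coeff_expo_yPoly, if_neg, mul_zero]
      exact fun h => hle ⟨h.1, by omega⟩

theorem hilbertSeries_and_basis_of_two_le (hn : 2 ≤ n) :
    hilbertSeries F n 2 =
        1 + PowerSeries.X ^ ((n - 1) * (q ^ 2 - q)) *
            (∑ k ∈ Finset.range (q + 1), PowerSeries.X ^ (k * (q - 1)))
          + PowerSeries.X ^ (n * (q ^ 2 - 1)) ∧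
    ∃ b : Module.Basis (Unit ⊕ Fin (q + 1) ⊕ Unit) F (invariants F n 2),
      (b (Sum.inl ()) : Q F n 2) = 1 ∧
      (∀ k : Fin (q + 1),
        (b (Sum.inr (Sum.inl k)) : Q F n 2) = Ideal.Quotient.mk _ (yPoly F n k)) ∧
      (b (Sum.inr (Sum.inr ())) : Q F n 2) = Ideal.Quotient.mk _ (zPoly F n) := by
  have hq : 1 < q := Fintype.one_lt_card
  let a : Fin n := ⟨0, by omega⟩
  have hpos : 0 < (n - 1) * q := Nat.mul_pos (by omega) (by omega)
  have hne : (fun _ => q + 1 : Fin n → ℕ) ≠ 0 := fun h => Nat.succ_ne_zero _ (congrFun h a)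
  have hcorner : ∀ k, corner q a k ≠ 0 := fun k h => by
    have := sum_corner q a k
    rw [h, Pi.zero_def, Finset.sum_const_zero] at this
    omega
  have hle : ∀ k : Fin (q + 1), (k : ℕ) ≤ q := fun k => Nat.le_of_lt_succ k.isLt
  have hy0 : ∀ k, coeff (expo F (0 : Fin n → ℕ)) (yPoly F n k) = 0 := fun k => by
    rw [coeff_expo_yPoly, if_neg]
    rintro ⟨-, h⟩
    rw [Pi.zero_def, Finset.sum_const_zero] at h
    omega
  obtain ⟨hH, b, hb⟩ := hilbertSeries_and_basis_of_dual (F := F) (n := n)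
    (Sum.elim (fun _ : Unit => 1) (Sum.elim (fun k : Fin (q + 1) => yPoly F n k)
      fun _ : Unit => zPoly F n))
    -- Exponents dual to the generators: the zero vector for `1`, the corner with entry `k` for
    -- `y_{n,k}`, and the all-`(q + 1)` vector for `z_n`.
    (Sum.elim (fun _ => 0) (Sum.elim (fun k => corner q a k) fun _ _ => q + 1))
    (by
      rintro (_ | k | _) j
      · exact Nat.zero_le _
      · exact (corner_le (hle k) a j).trans (Nat.le_succ _)
      · exact le_rfl)
    (by
      rintro (_ | k | _)
      · exact (map_one (Ideal.Quotient.mk (frobIdeal F n 2))).symm ▸ one_mem _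
      · exact (isReduced_yPoly _).mem_invariants
      · exact isReduced_zPoly.mem_invariants)
    (by
      rintro (_ | k | _)
      · simpa using isHomogeneous_one (Fin n) F
      · simpa [sum_corner] using isHomogeneous_yPoly (F := F) (n := n) (k : ℕ)
      · exact isHomogeneous_zPoly)
    (by
      rintro (_ | k | _) (_ | k' | _)
      · simp [coeff_expo_one]
      · simp [hy0]
      · simp [coeff_expo_zPoly, hne.symm]
      · simp [coeff_expo_one, hcorner]
      · simp [coeff_corner_yPoly (hle k), Fin.ext_iff]
      · simp [coeff_expo_zPoly, corner_ne_top (hle k)]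
      · simp [coeff_expo_one, hne]
      · simp [coeff_top_yPoly a]
      · simp [coeff_expo_zPoly])
    (by
      intro P hP i
      simp only [Fintype.sum_sum_type, Sum.elim_inl, Sum.elim_inr, Finset.univ_unique,
        Finset.sum_singleton]
      by_cases hi : i = 0
      · subst hi
        simp [coeff_expo_one, hy0, coeff_expo_zPoly, hne.symm]
      · rw [coeff_expo_one, if_neg hi, mul_zero, zero_add]
        exact hP.coeff_expo a (Or.inl hi))
    (by
      rintro (_ | k | _) d hd
      · refine ⟨0, ?_⟩
        rw [Sum.elim_inl, coeff_one] at hd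
        rw [expo_zero]
        exact by_contra fun h => hd (if_neg (Ne.symm h))
      · obtain ⟨i, -, hi⟩ := yPoly_supp _ d hd
        exact ⟨i, hi⟩
      · obtain ⟨i, -, hi⟩ := zPoly_supp d hd
        exact ⟨i, hi⟩)
  refine ⟨?_, b, (hb _).trans (map_one _), fun k => hb _, hb _⟩
  rw [hH]
  simp only [Fintype.sum_sum_type, Sum.elim_inl, Sum.elim_inr, Finset.univ_unique,
    Finset.sum_singleton, Pi.zero_apply, Finset.sum_const_zero, zero_mul, pow_zero, sum_corner]
  rw [← add_assoc, Finset.mul_sum, Finset.sum_range]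
  congr 2
  · refine Finset.sum_congr rfl fun k _ => ?_
    rw [← pow_add, pow_two, ← Nat.mul_sub_one, add_mul, mul_assoc]
  · rw [Finset.sum_const, Finset.card_univ, Fintype.card_fin, smul_eq_mul, mul_assoc,
      card_sq_sub_one]

theorem hilbertSeries_and_basis_of_eq_one (hn : n = 1) :
    hilbertSeries F n 2 =
        (∑ k ∈ Finset.range (q + 1), PowerSeries.X ^ (k * (q - 1))) +
          PowerSeries.X ^ (q ^ 2 - 1) ∧
    ∃ b : Module.Basis (Fin (q + 1) ⊕ Unit) F (invariants F n 2),
      (∀ k : Fin (q + 1),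
        (b (Sum.inl k) : Q F n 2) = Ideal.Quotient.mk _ (yPoly F n k)) ∧
      (b (Sum.inr ()) : Q F n 2) = Ideal.Quotient.mk _ (zPoly F n) := by
  subst hn
  have hle : ∀ k : Fin (q + 1), (k : ℕ) ≤ q := fun k => Nat.le_of_lt_succ k.isLt
  obtain ⟨hH, b, hb⟩ := hilbertSeries_and_basis_of_dual (F := F) (n := 1)
    (Sum.elim (fun k : Fin (q + 1) => yPoly F 1 k) fun _ : Unit => zPoly F 1)
    (Sum.elim (fun k => corner q 0 k) fun _ _ => q + 1)
    (by
      rintro (k | _) j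
      · exact (corner_le (hle k) 0 j).trans (Nat.le_succ _)
      · exact le_rfl)
    (by
      rintro (k | _)
      · exact (isReduced_yPoly _).mem_invariants
      · exact isReduced_zPoly.mem_invariants)
    (by
      rintro (k | _)
      · simpa only [Sum.elim_inl, sum_corner] using isHomogeneous_yPoly (F := F) (n := 1) (k : ℕ)
      · exact isHomogeneous_zPoly)
    (by
      rintro (k | _) (k' | _)
      · simp [coeff_corner_yPoly (hle k), Fin.ext_iff]
      · simp [coeff_expo_zPoly, corner_ne_top (hle k)]
      · simp [coeff_top_yPoly 0]
      · simp [coeff_expo_zPoly])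
    (by
      intro P hP i
      simp only [Fintype.sum_sum_type, Sum.elim_inl, Sum.elim_inr, Finset.univ_unique,
        Finset.sum_singleton]
      exact hP.coeff_expo 0 (Or.inr rfl))
    (by
      rintro (k | _) d hd
      · obtain ⟨i, -, hi⟩ := yPoly_supp _ d hd
        exact ⟨i, hi⟩
      · obtain ⟨i, -, hi⟩ := zPoly_supp d hd
        exact ⟨i, hi⟩)
  refine ⟨?_, b, fun k => hb _, hb _⟩
  rw [hH]
  simp only [Fintype.sum_sum_type, Sum.elim_inl, Sum.elim_inr, sum_corner]
  simp only [Finset.univ_unique, Finset.sum_singleton, Nat.sub_self, zero_mul, zero_add, Finset.sum_range,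
    card_sq_sub_one]

theorem yPoly_one_zero : yPoly F 1 0 = 1 := by
  rw [yPoly, Finset.sum_eq_single_of_mem 0]
  · simp
  · simp
  · intro i hi hne
    rw [Finset.mem_filter] at hi
    refine absurd (funext fun j => ?_) hne
    have : (i 0 : ℕ) = 0 := by simpa using hi.2
    rw [Subsingleton.elim j 0]
    exact Fin.ext this

end Main

/-! ### Power series identities behind the Lewis–Reiner–Stanton formula. -/

section Series

open PowerSeries

theorem one_sub_X_pow_mul_inv {d : ℕ} (hd : d ≠ 0) :
    (1 - X ^ d : PowerSeries ℚ) * (1 - X ^ d)⁻¹ = 1 := by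
  refine PowerSeries.mul_inv_cancel _ ?_
  simp [hd]

theorem eq_mul_inv_one_sub_X_pow {d : ℕ} (hd : d ≠ 0) {f g : PowerSeries ℚ}
    (h : f * (1 - X ^ d) = g) : f = g * (1 - X ^ d)⁻¹ := by
  rw [← h, mul_assoc, one_sub_X_pow_mul_inv hd, mul_one]

theorem sum_X_pow_mul_eq {q : ℕ} (hq : 2 ≤ q) :
    ∑ k ∈ Finset.range (q + 1), (X : PowerSeries ℚ) ^ (k * (q - 1)) =
      (1 - X ^ (q ^ 2 - 1)) * (1 - X ^ (q - 1))⁻¹ := by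
  refine eq_mul_inv_one_sub_X_pow (by omega) ?_
  have e : q ^ 2 - 1 = (q - 1) * (q + 1) := by
    rw [mul_comm, ← Nat.sq_sub_sq, one_pow]
  have := geom_sum_mul_neg ((X : PowerSeries ℚ) ^ (q - 1)) (q + 1)
  simp only [← pow_mul] at this
  rw [e, ← this]
  simp only [mul_comm (q - 1)]

theorem lrsSeries_one_two {q : ℕ} :
    lrsSeries q 1 2 =
      X ^ (q ^ 2 - 1) + (1 - X ^ (q ^ 2 - 1)) * (1 - X ^ (q - 1))⁻¹ := by
  simp [lrsSeries, qtBinom, Finset.sum_range_succ]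

/-- The summands `k = 0, 1, 2` correspond to `z_n`, to the family `y_{n,k}` and to `1`; in the last
one numerators and denominators cancel. -/
theorem lrsSeries_two {q n : ℕ} (hq : 2 ≤ q) (hn : 2 ≤ n) :
    lrsSeries q n 2 =
      X ^ (n * (q ^ 2 - 1)) + X ^ ((n - 1) * (q ^ 2 - q)) *
        ((1 - X ^ (q ^ 2 - 1)) * (1 - X ^ (q - 1))⁻¹) + 1 := by
  have h4 : q * 2 ≤ q ^ 2 := by rw [pow_two]; exact Nat.mul_le_mul_left _ hq
  rw [lrsSeries, min_eq_right hn]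
  simp only [qtBinom, Finset.sum_range_succ, Finset.prod_range_succ, Finset.range_zero,
    Finset.sum_empty, Finset.prod_empty, pow_zero, pow_one, Nat.sub_self, mul_zero, zero_add,
    one_mul, mul_one, Nat.sub_zero]
  rw [one_sub_X_pow_mul_inv (by omega), one_sub_X_pow_mul_inv (by omega), mul_one]

end Series

end FrobInv

open FrobInv in
theorem mainTheorem1 (F : Type*) [Field F] [Fintype F] (q : ℕ) (hq : Fintype.card F = q)
    (n : ℕ) :
    (2 ≤ n →
      hilbertSeries F n 2 =
          1 + PowerSeries.X ^ ((n - 1) * (q ^ 2 - q)) *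
              (∑ k ∈ Finset.range (q + 1), PowerSeries.X ^ (k * (q - 1)))
            + PowerSeries.X ^ (n * (q ^ 2 - 1)) ∧
      ∃ b : Module.Basis (Unit ⊕ Fin (q + 1) ⊕ Unit) F (invariants F n 2),
        (b (Sum.inl ()) : Q F n 2) = 1 ∧
        (∀ k : Fin (q + 1),
          (b (Sum.inr (Sum.inl k)) : Q F n 2) = Ideal.Quotient.mk _ (yPoly F n k)) ∧
        (b (Sum.inr (Sum.inr ())) : Q F n 2) = Ideal.Quotient.mk _ (zPoly F n)) ∧
    (n = 1 →
      hilbertSeries F n 2 =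
          (1 - PowerSeries.X ^ (q ^ 2 + q - 2)) * (1 - PowerSeries.X ^ (q - 1))⁻¹ ∧
      ∃ b : Module.Basis (Fin (q + 1) ⊕ Unit) F (invariants F n 2),
        (b (Sum.inl 0) : Q F n 2) = 1 ∧
        (∀ k : Fin (q + 1),
          (b (Sum.inl k) : Q F n 2) = Ideal.Quotient.mk _ (yPoly F n k)) ∧
        (b (Sum.inr ()) : Q F n 2) = Ideal.Quotient.mk _ (zPoly F n)) ∧
    (1 ≤ n → hilbertSeries F n 2 = lrsSeries q n 2) := by
  subst hq
  have hq : 2 ≤ Fintype.card F := Fintype.one_lt_card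
  refine ⟨hilbertSeries_and_basis_of_two_le, fun hn => ?_, fun hn => ?_⟩
  · obtain ⟨hH, b, hy, hz⟩ := hilbertSeries_and_basis_of_eq_one (F := F) hn
    refine ⟨?_, b, ?_, hy, hz⟩
    · rw [hH, sum_X_pow_mul_eq hq]
      refine eq_mul_inv_one_sub_X_pow (by omega) ?_
      rw [add_mul, mul_assoc, mul_comm (_⁻¹), one_sub_X_pow_mul_inv (by omega), mul_one, mul_sub,
        ← pow_add, show Fintype.card F ^ 2 - 1 + (Fintype.card F - 1) =
          Fintype.card F ^ 2 + Fintype.card F - 2 by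
            have := Nat.pow_le_pow_left hq 2
            omega]
      ring
    · subst hn
      rw [hy, Fin.val_zero, yPoly_one_zero, map_one]
  · rcases hn.eq_or_lt with rfl | hn
    · rw [(hilbertSeries_and_basis_of_eq_one rfl).1, lrsSeries_one_two, sum_X_pow_mul_eq hq, add_comm]
    · rw [(hilbertSeries_and_basis_of_two_le hn).1, lrsSeries_two hq hn, sum_X_pow_mul_eq hq]
      ring
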